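/- Let $n\ge 2$, and let $\mathcal O_n$ be the Cuntz algebra, i.e. a (nonzero, unital) $C^*$-algebra generated by isometries $S_1,\dots,S_n$ with mutually orthogonal ranges and $\sum_{i=1}^n S_iS_i^*=1$. For a word $\alpha=(i_1,\dots,i_k)\in\{1,\dots,n\}^k$ put $S_\alpha=S_{i_1}\cdots S_{i_k}$ and $|\alpha|=k$. Let $\mathcal F_n$ be the norm closure of $\bigcup_{k\ge 0}\operatorname{span}\{S_\alpha S_\beta^*: |\alpha|=|\beta|=k\}$ (the UHF core), and let $\mathcal D_n$ be the norm closure of $\bigcup_{k\ge 0}\operatorname{span}\{S_\alpha S_\alpha^*: |\alpha|=k\}$ (the diagonal). Let $w$ be a unitary in $\mathcal O_n$. Then there is a unique unital $*$-endomorphism $\lambda_w$ of $\mathcal O_n$ with $\lambda_w(S_i)=w^*S_i$ for $i=1,\dots,n$, and the following hold. (a) If $w\in\mathcal F_n$, then $\lambda_w$ is an automorphism of $\mathcal O_n$ if and only if $\lambda_w(\mathcal F_n)=\mathcal F_n$. (b) If $\lambda_w$ is an automorphism of $\mathcal O_n$, then $\lambda_w(\mathcal D_n)=\mathcal D_n$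 if and only if $w\mathcal D_nw^*=\mathcal D_n$. (c) If $\lambda_w(\mathcal D_n)=\mathcal D_n$, then $\lambda_w$ is irreducible: $\lambda_w(\mathcal O_n)'\cap\mathcal O_n=\mathbb C1$, i.e. the only elements of $\mathcal O_n$ commuting with every element of $\lambda_w(\mathcal O_n)$ are the scalar multiples of $1$. -/

import Mathlib

/-- `S` exhibits the unital C*-algebra `A` as the Cuntz algebra on `n` generators: the `S i` are
isometries with mutually orthogonal ranges whose range projections sum to `1`, and they generate
`A` as a C*-algebra. -/
structure IsCuntzFamily {A : Type*} [CStarAlgebra A] {n : ℕ} (S : Fin n → A) : Prop where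
  isometry : ∀ i, star (S i) * S i = 1
  orthogonal : ∀ i j, i ≠ j → star (S i) * S j = 0
  sum_range : ∑ i, S i * star (S i) = 1
  generates : (StarAlgebra.adjoin ℂ (Set.range S)).topologicalClosure = ⊤

/-- For a word `α = [i₁, …, i_k]`, the product `S_α = S_{i₁} ⋯ S_{i_k}`
(the empty word gives `1`). -/
noncomputable def cuntzWord {A : Type*} [CStarAlgebra A] {n : ℕ} (S : Fin n → A) (α : List (Fin n)) : A :=
  (α.map S).prod

/-- The level `k` matrix algebra `F_n^k`, spanned by the matrix units `S_α S_β*` with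
`|α| = |β| = k`. -/
noncomputable def cuntzCoreLevel {A : Type*} [CStarAlgebra A] {n : ℕ} (S : Fin n → A) (k : ℕ) :
    Submodule ℂ A :=
  Submodule.span ℂ {x | ∃ α β : List (Fin n), α.length = k ∧ β.length = k ∧
    x = cuntzWord S α * star (cuntzWord S β)}

/-- The core UHF algebra `F_n`: the norm closure of the union of the `F_n^k`. -/
noncomputable def cuntzCore {A : Type*} [CStarAlgebra A] {n : ℕ} (S : Fin n → A) : Set A :=
  closure (⋃ k : ℕ, (cuntzCoreLevel S k : Set A))

/-- The level `k` diagonal `D_n^k`, spanned by the projections `S_α S_α*` with `|α| = k`. -/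
noncomputable def cuntzDiagonalLevel {A : Type*} [CStarAlgebra A] {n : ℕ} (S : Fin n → A) (k : ℕ) :
    Submodule ℂ A :=
  Submodule.span ℂ {x | ∃ α : List (Fin n), α.length = k ∧
    x = cuntzWord S α * star (cuntzWord S α)}

/-- The diagonal `D_n`: the norm closure of the union of the `D_n^k`. -/
noncomputable def cuntzDiagonal {A : Type*} [CStarAlgebra A] {n : ℕ} (S : Fin n → A) : Set A :=
  closure (⋃ k : ℕ, (cuntzDiagonalLevel S k : Set A))

/-- The unitary normalizer of a subset `D` of `A`: all unitaries `z` with `z D z* = D`. -/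
def unitaryNormalizer {A : Type*} [CStarAlgebra A] (D : Set A) : Set A :=
  {z | z ∈ unitary A ∧ (fun d => z * d * star z) '' D = D}

namespace IsCuntzFamily

/-! ### Matrix calculus with corners, and the shift endomorphism. -/

section Relations

variable {A : Type*} [CStarAlgebra A] {n : ℕ} {S : Fin n → A}

/-! Three facts carry the theorem: simplicity of `A`, a faithful conditional expectation `E` onto
the core, and the fact that the diagonal `D` is a masa.

The expectation is built without the gauge action. Let `W` be the image of `S_i^m S_j`, with `i ≠
j`, under the `a`-th power of the shift. It is an isometry commuting with level `a` of the core, and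
for large `a` and `m` the compression `W* x W` fixes a given element of the algebraic core and kills
a given element of nonzero degree. Elements `y S_i^d` and `(S_i*)^d y` with `y` in the algebraic
core span a dense subspace, so compressions converge to `E` (`tendsto_coreExpectation`). Sums of
probes with different `a` yield Fejér means, and these show that `E` is faithful
(`eq_zero_of_coreExpectation_eq_zero`).

A unital homomorphism into a nonzero algebra is injective on each level, hence isometric on the
core, hence injective by faithfulness of `E` (`injective_of_nontrivial`). Applied to the algebra
generated by the pairs `(S_i, T_i)`, this gives the universal property `exists_hom`, and so the
existence of `λ_w`. An element commuting with `D` lies in the core because the range projections of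
the probes are in `D`, and then in `D` by block-diagonal approximation
(`mem_diagonalAlgebra_of_commute`).

For (a): when `w` is in the core, `λ_w` preserves degree and so commutes with `E`
(`map_coreExpectation`); thus preimages of core elements are in the core. Conversely, if `w =
λ_w(v)` then `λ_w(v S_l) = S_l`, which gives surjectivity. For (b): `λ_w(S_i x S_i*) = w* S_i λ_w(x)
S_i* w` links conjugation by `w` to `λ_w` on `D`; equality rather than inclusion comes from the masa
property. For (c): an element of the commutant commutes with `λ_w(D) = D`, so it is `λ_w(y)` with
`y` in `D`; then `y` commutes with the generators and is scalar. -/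

theorem star_mul_eq_ite (hS : IsCuntzFamily S) (i j : Fin n) :
    star (S i) * S j = if i = j then 1 else 0 := by
  split_ifs with h
  · rw [h, hS.isometry]
  · exact hS.orthogonal i j h

theorem star_mul_cancel (hS : IsCuntzFamily S) (i : Fin n) (x : A) :
    star (S i) * (S i * x) = x := by
  rw [← mul_assoc, hS.isometry, one_mul]

theorem corner_of_conj (hS : IsCuntzFamily S) (a b i j : Fin n) (x : A) :
    star (S a) * (S i * x * star (S j)) * S b = if a = i ∧ j = b then x else 0 := by
  have : star (S a) * (S i * x * star (S j)) * S b
      = (star (S a) * S i) * x * (star (S j) * S b) := by simp only [mul_assoc]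
  rw [this, hS.star_mul_eq_ite, hS.star_mul_eq_ite]
  by_cases h1 : a = i <;> by_cases h2 : j = b <;> simp [h1, h2]

/-- An element is recovered from its matrix of corners. -/
theorem sum_corner (hS : IsCuntzFamily S) (x : A) :
    ∑ i, ∑ j, S i * (star (S i) * x * S j) * star (S j) = x := by
  calc ∑ i, ∑ j, S i * (star (S i) * x * S j) * star (S j)
      = (∑ i, S i * star (S i)) * x * (∑ j, S j * star (S j)) := by
        simp only [Finset.sum_mul, Finset.mul_sum, mul_assoc]
        exact Finset.sum_comm
    _ = x := by rw [hS.sum_range, one_mul, mul_one]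

theorem corner_mul (hS : IsCuntzFamily S) (x y : A) (i j : Fin n) :
    star (S i) * (x * y) * S j = ∑ l, (star (S i) * x * S l) * (star (S l) * y * S j) := by
  calc star (S i) * (x * y) * S j
      = star (S i) * x * (∑ l, S l * star (S l)) * (y * S j) := by
        rw [hS.sum_range]; simp only [mul_assoc, one_mul]
    _ = _ := by simp only [Finset.sum_mul, Finset.mul_sum, mul_assoc]

/-- The corners identify `A` with the `n × n` matrices over `A`; identities are checked entrywise in
this picture. -/
theorem ext_corner (hS : IsCuntzFamily S) {x y : A}
    (h : ∀ i j, star (S i) * x * S j = star (S i) * y * S j) : x = y := by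
  rw [← hS.sum_corner x, ← hS.sum_corner y]
  simp only [h]

theorem corner_sum_conj (hS : IsCuntzFamily S) (f : Fin n → A) (a b : Fin n) :
    star (S a) * (∑ i, S i * f i * star (S i)) * S b = if a = b then f a else 0 := by
  simp only [Finset.mul_sum, Finset.sum_mul, hS.corner_of_conj]
  split_ifs with h
  · subst h
    rw [Finset.sum_eq_single a] <;> simp +contextual [eq_comm]
  · refine Finset.sum_eq_zero fun i _ => if_neg ?_
    rintro ⟨rfl, rfl⟩
    exact h rfl

/-- The canonical shift endomorphism `x ↦ ∑ S_i x S_i*`. -/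
noncomputable def shift (hS : IsCuntzFamily S) : A →⋆ₐ[ℂ] A where
  toFun x := ∑ i, S i * x * star (S i)
  map_one' := by simp [hS.sum_range]
  map_mul' x y := by
    refine hS.ext_corner fun a b => ?_
    rw [hS.corner_mul]
    simp only [hS.corner_sum_conj]
    by_cases h : a = b <;> simp [h]
  map_zero' := by simp
  map_add' x y := by simp [mul_add, add_mul, Finset.sum_add_distrib]
  commutes' c := by
    simp [← Algebra.commutes c, mul_assoc, ← Finset.mul_sum, hS.sum_range]
  map_star' x := by simp [mul_assoc]

theorem shift_apply (hS : IsCuntzFamily S) (x : A) :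
    hS.shift x = ∑ i, S i * x * star (S i) := rfl

theorem corner_shift (hS : IsCuntzFamily S) (x : A) (i j : Fin n) :
    star (S i) * hS.shift x * S j = if i = j then x else 0 := by
  rw [shift_apply, hS.corner_sum_conj]

theorem shift_mul_generator (hS : IsCuntzFamily S) (x : A) (i : Fin n) :
    hS.shift x * S i = S i * x := by
  simp only [shift_apply, Finset.sum_mul, mul_assoc, hS.star_mul_eq_ite]
  simp

/-- The iterates of the shift endomorphism. -/
noncomputable def shiftPow (hS : IsCuntzFamily S) : ℕ → (A →⋆ₐ[ℂ] A)
  | 0 => StarAlgHom.id ℂ A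
  | k + 1 => hS.shift.comp (shiftPow hS k)

@[simp] theorem shiftPow_zero (hS : IsCuntzFamily S) (x : A) : hS.shiftPow 0 x = x := rfl

theorem shiftPow_succ (hS : IsCuntzFamily S) (k : ℕ) (x : A) :
    hS.shiftPow (k + 1) x = hS.shift (hS.shiftPow k x) := rfl

theorem shiftPow_add (hS : IsCuntzFamily S) (k l : ℕ) (x : A) :
    hS.shiftPow (k + l) x = hS.shiftPow k (hS.shiftPow l x) := by
  induction k with
  | zero => simp
  | succ k ih => rw [Nat.succ_add_eq_add_succ, Nat.add_succ, shiftPow_succ, ih, shiftPow_succ]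

/-- Moving `S_i^d` to the other side costs `d` shifts; this is how the degree of an element becomes
visible to the probes. -/
theorem shiftPow_mul_pow (hS : IsCuntzFamily S) (d : ℕ) (x : A) (i : Fin n) :
    hS.shiftPow d x * S i ^ d = S i ^ d * x := by
  induction d with
  | zero => simp
  | succ d ih =>
    rw [shiftPow_succ, pow_succ', ← mul_assoc, hS.shift_mul_generator, mul_assoc, ih, mul_assoc]

theorem star_pow_mul_shiftPow (hS : IsCuntzFamily S) (d : ℕ) (x : A) (i : Fin n) :
    star (S i ^ d) * hS.shiftPow d x = x * star (S i ^ d) := by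
  have := congrArg star (hS.shiftPow_mul_pow d (star x) i)
  simpa [map_star] using this

theorem star_pow_mul_pow (hS : IsCuntzFamily S) (d : ℕ) (i : Fin n) :
    star (S i ^ d) * S i ^ d = 1 := by
  induction d with
  | zero => simp
  | succ d ih => rw [pow_succ', star_mul, mul_assoc, hS.star_mul_cancel, ih]

end Relations

/-! ### Levels of the core and of the diagonal. -/

section Levels

variable {A : Type*} [CStarAlgebra A] {n : ℕ} {S : Fin n → A}

theorem mem_coreLevel_zero {x : A} :
    x ∈ cuntzCoreLevel S 0 ↔ ∃ c : ℂ, algebraMap ℂ A c = x := by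
  have : {x : A | ∃ α β : List (Fin n), α.length = 0 ∧ β.length = 0 ∧
      x = cuntzWord S α * star (cuntzWord S β)} = {1} := by
    ext y
    simp [cuntzWord]
  rw [cuntzCoreLevel, this, Submodule.mem_span_singleton]
  simp [Algebra.algebraMap_eq_smul_one]

theorem mem_diagonalLevel_zero {x : A} :
    x ∈ cuntzDiagonalLevel S 0 ↔ ∃ c : ℂ, algebraMap ℂ A c = x := by
  have : {x : A | ∃ α : List (Fin n), α.length = 0 ∧
      x = cuntzWord S α * star (cuntzWord S α)} = {1} := by
    ext y
    simp [cuntzWord]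
  rw [cuntzDiagonalLevel, this, Submodule.mem_span_singleton]
  simp [Algebra.algebraMap_eq_smul_one]

theorem cuntzWord_cons (i : Fin n) (α : List (Fin n)) :
    cuntzWord S (i :: α) = S i * cuntzWord S α := by
  simp [cuntzWord]

theorem conj_mem_coreLevel {k : ℕ} {x : A} (hx : x ∈ cuntzCoreLevel S k) (i j : Fin n) :
    S i * x * star (S j) ∈ cuntzCoreLevel S (k + 1) := by
  induction hx using Submodule.span_induction with
  | mem x h =>
    obtain ⟨α, β, hα, hβ, rfl⟩ := h
    refine Submodule.subset_span ⟨i :: α, j :: β, by simp [hα], by simp [hβ], ?_⟩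
    simp [cuntzWord_cons, mul_assoc]
  | zero => simp
  | add x y _ _ hx hy => simpa [mul_add, add_mul] using add_mem hx hy
  | smul c x _ hx => simpa using Submodule.smul_mem _ c hx

theorem conj_mem_diagonalLevel {k : ℕ} {x : A} (hx : x ∈ cuntzDiagonalLevel S k) (i : Fin n) :
    S i * x * star (S i) ∈ cuntzDiagonalLevel S (k + 1) := by
  induction hx using Submodule.span_induction with
  | mem x h =>
    obtain ⟨α, hα, rfl⟩ := h
    refine Submodule.subset_span ⟨i :: α, by simp [hα], ?_⟩
    simp [cuntzWord_cons, mul_assoc]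
  | zero => simp
  | add x y _ _ hx hy => simpa [mul_add, add_mul] using add_mem hx hy
  | smul c x _ hx => simpa using Submodule.smul_mem _ c hx

/-- In the matrix picture, level `k + 1` is the matrices over level `k`. Statements about levels
thus reduce by induction to scalars, with no calculation on words. -/
theorem mem_coreLevel_succ (hS : IsCuntzFamily S) {k : ℕ} {x : A} :
    x ∈ cuntzCoreLevel S (k + 1) ↔ ∀ i j, star (S i) * x * S j ∈ cuntzCoreLevel S k := by
  constructor
  · intro hx i j
    induction hx using Submodule.span_induction with
    | mem x h =>
      obtain ⟨α, β, hα, hβ, rfl⟩ := h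
      obtain ⟨a, α, rfl⟩ := List.exists_cons_of_length_eq_add_one hα
      obtain ⟨b, β, rfl⟩ := List.exists_cons_of_length_eq_add_one hβ
      have : star (S i) * (cuntzWord S (a :: α) * star (cuntzWord S (b :: β))) * S j
          = star (S i) * (S a * (cuntzWord S α * star (cuntzWord S β)) * star (S b)) * S j := by
        simp [cuntzWord_cons, mul_assoc]
      rw [this, hS.corner_of_conj]
      split_ifs
      · exact Submodule.subset_span ⟨α, β, by simpa using hα, by simpa using hβ, rfl⟩
      · exact zero_mem _
    | zero => simp
    | add x y _ _ hx hy => simpa [mul_add, add_mul] using add_mem hx hy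
    | smul c x _ hx => simpa using Submodule.smul_mem _ c hx
  · intro h
    rw [← hS.sum_corner x]
    exact Submodule.sum_mem _ fun i _ => Submodule.sum_mem _ fun j _ => conj_mem_coreLevel (h i j) i j

theorem mem_diagonalLevel_succ (hS : IsCuntzFamily S) {k : ℕ} {x : A} :
    x ∈ cuntzDiagonalLevel S (k + 1) ↔ (∀ i, star (S i) * x * S i ∈ cuntzDiagonalLevel S k) ∧
      ∀ i j, i ≠ j → star (S i) * x * S j = 0 := by
  constructor
  · intro hx
    induction hx using Submodule.span_induction with
    | mem x h =>
      obtain ⟨α, hα, rfl⟩ := h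
      obtain ⟨a, α, rfl⟩ := List.exists_cons_of_length_eq_add_one hα
      have (i j : Fin n) : star (S i) * (cuntzWord S (a :: α) * star (cuntzWord S (a :: α))) * S j
          = if i = a ∧ a = j then cuntzWord S α * star (cuntzWord S α) else 0 := by
        rw [← hS.corner_of_conj]
        simp [cuntzWord_cons, mul_assoc]
      refine ⟨fun i => ?_, fun i j hij => ?_⟩
      · rw [this]
        split_ifs
        · exact Submodule.subset_span ⟨α, by simpa using hα, rfl⟩
        · exact zero_mem _
      · rw [this, if_neg]
        rintro ⟨rfl, rfl⟩
        exact hij rfl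
    | zero => simp
    | add x y _ _ hx hy =>
      refine ⟨fun i => ?_, fun i j hij => ?_⟩
      · simpa [mul_add, add_mul] using add_mem (hx.1 i) (hy.1 i)
      · simp [mul_add, add_mul, hx.2 i j hij, hy.2 i j hij]
    | smul c x _ hx =>
      refine ⟨fun i => ?_, fun i j hij => ?_⟩
      · simpa using Submodule.smul_mem _ c (hx.1 i)
      · simp [hx.2 i j hij]
  · rintro ⟨h, h0⟩
    rw [← hS.sum_corner x]
    refine Submodule.sum_mem _ fun i _ => Submodule.sum_mem _ fun j _ => ?_
    rcases eq_or_ne i j with rfl | hij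
    · exact conj_mem_diagonalLevel (h i) i
    · simp [h0 i j hij]

theorem algebraMap_mem_coreLevel (hS : IsCuntzFamily S) (k : ℕ) (c : ℂ) :
    algebraMap ℂ A c ∈ cuntzCoreLevel S k := by
  induction k with
  | zero => exact mem_coreLevel_zero.2 ⟨c, rfl⟩
  | succ k ih =>
    refine hS.mem_coreLevel_succ.2 fun i j => ?_
    rw [← Algebra.commutes, mul_assoc, hS.star_mul_eq_ite]
    split_ifs <;> simp [ih]

theorem algebraMap_mem_diagonalLevel (hS : IsCuntzFamily S) (k : ℕ) (c : ℂ) :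
    algebraMap ℂ A c ∈ cuntzDiagonalLevel S k := by
  induction k with
  | zero => exact mem_diagonalLevel_zero.2 ⟨c, rfl⟩
  | succ k ih =>
    refine hS.mem_diagonalLevel_succ.2 ⟨fun i => ?_, fun i j hij => ?_⟩
    · rwa [← Algebra.commutes, mul_assoc, hS.isometry, mul_one]
    · rw [← Algebra.commutes, mul_assoc, hS.orthogonal i j hij, mul_zero]

theorem coreLevel_le_succ (hS : IsCuntzFamily S) (k : ℕ) :
    cuntzCoreLevel S k ≤ cuntzCoreLevel S (k + 1) := by
  induction k with
  | zero =>
    intro x hx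
    obtain ⟨c, rfl⟩ := mem_coreLevel_zero.1 hx
    exact hS.algebraMap_mem_coreLevel _ c
  | succ k ih =>
    intro x hx
    exact hS.mem_coreLevel_succ.2 fun i j => ih (hS.mem_coreLevel_succ.1 hx i j)

theorem coreLevel_mono (hS : IsCuntzFamily S) : Monotone (cuntzCoreLevel S) :=
  monotone_nat_of_le_succ hS.coreLevel_le_succ

theorem diagonalLevel_le_succ (hS : IsCuntzFamily S) (k : ℕ) :
    cuntzDiagonalLevel S k ≤ cuntzDiagonalLevel S (k + 1) := by
  induction k with
  | zero =>
    intro x hx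
    obtain ⟨c, rfl⟩ := mem_diagonalLevel_zero.1 hx
    exact hS.algebraMap_mem_diagonalLevel _ c
  | succ k ih =>
    intro x hx
    have h := hS.mem_diagonalLevel_succ.1 hx
    exact hS.mem_diagonalLevel_succ.2 ⟨fun i => ih (h.1 i), h.2⟩

theorem diagonalLevel_mono (hS : IsCuntzFamily S) : Monotone (cuntzDiagonalLevel S) :=
  monotone_nat_of_le_succ hS.diagonalLevel_le_succ

theorem diagonalLevel_le_coreLevel (k : ℕ) : cuntzDiagonalLevel S k ≤ cuntzCoreLevel S k :=
  Submodule.span_mono fun _ ⟨α, hα, hx⟩ => ⟨α, α, hα, hα, hx⟩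

theorem mul_mem_coreLevel (hS : IsCuntzFamily S) {k : ℕ} {x y : A}
    (hx : x ∈ cuntzCoreLevel S k) (hy : y ∈ cuntzCoreLevel S k) : x * y ∈ cuntzCoreLevel S k := by
  induction k generalizing x y with
  | zero =>
    obtain ⟨c, rfl⟩ := mem_coreLevel_zero.1 hx
    obtain ⟨d, rfl⟩ := mem_coreLevel_zero.1 hy
    exact mem_coreLevel_zero.2 ⟨c * d, by simp⟩
  | succ k ih =>
    refine hS.mem_coreLevel_succ.2 fun i j => ?_
    rw [hS.corner_mul]
    exact Submodule.sum_mem _ fun l _ =>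
      ih (hS.mem_coreLevel_succ.1 hx i l) (hS.mem_coreLevel_succ.1 hy l j)

theorem star_mem_coreLevel (hS : IsCuntzFamily S) {k : ℕ} {x : A}
    (hx : x ∈ cuntzCoreLevel S k) : star x ∈ cuntzCoreLevel S k := by
  induction k generalizing x with
  | zero =>
    obtain ⟨c, rfl⟩ := mem_coreLevel_zero.1 hx
    exact mem_coreLevel_zero.2 ⟨star c, algebraMap_star_comm c⟩
  | succ k ih =>
    refine hS.mem_coreLevel_succ.2 fun i j => ?_
    simpa [mul_assoc] using ih (hS.mem_coreLevel_succ.1 hx j i)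

theorem corner_mul_diagonal (hS : IsCuntzFamily S) {x y : A}
    (hx : ∀ i j, i ≠ j → star (S i) * x * S j = 0) (i j : Fin n) :
    star (S i) * (x * y) * S j = (star (S i) * x * S i) * (star (S i) * y * S j) := by
  rw [hS.corner_mul, Finset.sum_eq_single i]
  · intro l _ hl
    rw [hx i l hl.symm, zero_mul]
  · simp

theorem mul_mem_diagonalLevel (hS : IsCuntzFamily S) {k : ℕ} {x y : A}
    (hx : x ∈ cuntzDiagonalLevel S k) (hy : y ∈ cuntzDiagonalLevel S k) :
    x * y ∈ cuntzDiagonalLevel S k := by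
  induction k generalizing x y with
  | zero =>
    obtain ⟨c, rfl⟩ := mem_diagonalLevel_zero.1 hx
    obtain ⟨d, rfl⟩ := mem_diagonalLevel_zero.1 hy
    exact mem_diagonalLevel_zero.2 ⟨c * d, by simp⟩
  | succ k ih =>
    have h1 := hS.mem_diagonalLevel_succ.1 hx
    have h2 := hS.mem_diagonalLevel_succ.1 hy
    refine hS.mem_diagonalLevel_succ.2 ⟨fun i => ?_, fun i j hij => ?_⟩
    · rw [hS.corner_mul_diagonal h1.2]
      exact ih (h1.1 i) (h2.1 i)
    · rw [hS.corner_mul_diagonal h1.2, h2.2 i j hij, mul_zero]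

theorem commute_of_mem_diagonalLevel (hS : IsCuntzFamily S) {k : ℕ} {x y : A}
    (hx : x ∈ cuntzDiagonalLevel S k) (hy : y ∈ cuntzDiagonalLevel S k) : x * y = y * x := by
  induction k generalizing x y with
  | zero =>
    obtain ⟨c, rfl⟩ := mem_diagonalLevel_zero.1 hx
    exact Algebra.commutes c y
  | succ k ih =>
    have h1 := hS.mem_diagonalLevel_succ.1 hx
    have h2 := hS.mem_diagonalLevel_succ.1 hy
    refine hS.ext_corner fun i j => ?_
    rw [hS.corner_mul_diagonal h1.2, hS.corner_mul_diagonal h2.2]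
    rcases eq_or_ne i j with rfl | hij
    · exact ih (h1.1 i) (h2.1 i)
    · rw [h1.2 i j hij, h2.2 i j hij, mul_zero, mul_zero]

theorem star_mem_diagonalLevel (hS : IsCuntzFamily S) {k : ℕ} {x : A}
    (hx : x ∈ cuntzDiagonalLevel S k) : star x ∈ cuntzDiagonalLevel S k := by
  induction k generalizing x with
  | zero =>
    obtain ⟨c, rfl⟩ := mem_diagonalLevel_zero.1 hx
    exact mem_diagonalLevel_zero.2 ⟨star c, algebraMap_star_comm c⟩
  | succ k ih =>
    have h := hS.mem_diagonalLevel_succ.1 hx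
    refine hS.mem_diagonalLevel_succ.2 ⟨fun i => ?_, fun i j hij => ?_⟩
    · simpa [mul_assoc] using ih (h.1 i)
    · simpa [mul_assoc] using congrArg star (h.2 j i hij.symm)

/-- As a matrix, a shifted element is constant on the diagonal and zero elsewhere, so it commutes
with a matrix as soon as its diagonal entry commutes with all entries; each level uses up one shift.
-/
theorem shiftPow_commute (hS : IsCuntzFamily S) {k a : ℕ} (hka : k ≤ a) {y : A}
    (hy : y ∈ cuntzCoreLevel S k) (x : A) : hS.shiftPow a x * y = y * hS.shiftPow a x := by
  induction k generalizing y a with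
  | zero =>
    obtain ⟨c, rfl⟩ := mem_coreLevel_zero.1 hy
    exact (Algebra.commutes c _).symm
  | succ k ih =>
    obtain ⟨a, rfl⟩ := Nat.exists_eq_add_of_le' (Nat.one_le_of_lt hka)
    refine hS.ext_corner fun i j => ?_
    rw [shiftPow_succ, hS.corner_mul, hS.corner_mul]
    simp only [hS.corner_shift]
    simpa using ih (Nat.le_of_succ_le_succ hka) (hS.mem_coreLevel_succ.1 hy i j)

instance finiteDimensional_coreLevel (k : ℕ) :
    FiniteDimensional ℂ (cuntzCoreLevel S k) := by
  apply FiniteDimensional.span_of_finite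
  have hf : {α : List (Fin n) | α.length = k}.Finite := List.finite_length_eq (Fin n) k
  refine ((hf.prod hf).image fun p => cuntzWord S p.1 * star (cuntzWord S p.2)).subset ?_
  rintro x ⟨α, β, hα, hβ, rfl⟩
  exact ⟨(α, β), ⟨hα, hβ⟩, rfl⟩

/-- The level `k` of the core as a star subalgebra. -/
noncomputable def coreLevelAlgebra (hS : IsCuntzFamily S) (k : ℕ) : StarSubalgebra ℂ A where
  carrier := cuntzCoreLevel S k
  mul_mem' := hS.mul_mem_coreLevel
  add_mem' := add_mem
  algebraMap_mem' := hS.algebraMap_mem_coreLevel k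
  star_mem' := hS.star_mem_coreLevel

theorem isClosed_coreLevelAlgebra (hS : IsCuntzFamily S) (k : ℕ) :
    IsClosed (hS.coreLevelAlgebra k : Set A) :=
  (cuntzCoreLevel S k).closed_of_finiteDimensional

/-- The algebraic core, the union of the levels. -/
noncomputable def algebraicCore (hS : IsCuntzFamily S) : StarSubalgebra ℂ A where
  carrier := ⋃ k, (cuntzCoreLevel S k : Set A)
  mul_mem' {x y} hx hy := by
    obtain ⟨k, hk⟩ := Set.mem_iUnion.1 hx
    obtain ⟨l, hl⟩ := Set.mem_iUnion.1 hy
    exact Set.mem_iUnion.2 ⟨max k l, hS.mul_mem_coreLevel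
      (hS.coreLevel_mono (le_max_left k l) hk) (hS.coreLevel_mono (le_max_right k l) hl)⟩
  add_mem' {x y} hx hy := by
    obtain ⟨k, hk⟩ := Set.mem_iUnion.1 hx
    obtain ⟨l, hl⟩ := Set.mem_iUnion.1 hy
    exact Set.mem_iUnion.2 ⟨max k l, add_mem
      (hS.coreLevel_mono (le_max_left k l) hk) (hS.coreLevel_mono (le_max_right k l) hl)⟩
  algebraMap_mem' c := Set.mem_iUnion.2 ⟨0, hS.algebraMap_mem_coreLevel 0 c⟩
  star_mem' {x} hx := by
    obtain ⟨k, hk⟩ := Set.mem_iUnion.1 hx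
    exact Set.mem_iUnion.2 ⟨k, hS.star_mem_coreLevel hk⟩

/-- The algebraic diagonal, the union of the levels. -/
noncomputable def algebraicDiagonal (hS : IsCuntzFamily S) : StarSubalgebra ℂ A where
  carrier := ⋃ k, (cuntzDiagonalLevel S k : Set A)
  mul_mem' {x y} hx hy := by
    obtain ⟨k, hk⟩ := Set.mem_iUnion.1 hx
    obtain ⟨l, hl⟩ := Set.mem_iUnion.1 hy
    exact Set.mem_iUnion.2 ⟨max k l, hS.mul_mem_diagonalLevel
      (hS.diagonalLevel_mono (le_max_left k l) hk) (hS.diagonalLevel_mono (le_max_right k l) hl)⟩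
  add_mem' {x y} hx hy := by
    obtain ⟨k, hk⟩ := Set.mem_iUnion.1 hx
    obtain ⟨l, hl⟩ := Set.mem_iUnion.1 hy
    exact Set.mem_iUnion.2 ⟨max k l, add_mem
      (hS.diagonalLevel_mono (le_max_left k l) hk) (hS.diagonalLevel_mono (le_max_right k l) hl)⟩
  algebraMap_mem' c := Set.mem_iUnion.2 ⟨0, hS.algebraMap_mem_diagonalLevel 0 c⟩
  star_mem' {x} hx := by
    obtain ⟨k, hk⟩ := Set.mem_iUnion.1 hx
    exact Set.mem_iUnion.2 ⟨k, hS.star_mem_diagonalLevel hk⟩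

theorem mem_algebraicCore (hS : IsCuntzFamily S) {x : A} :
    x ∈ hS.algebraicCore ↔ ∃ k, x ∈ cuntzCoreLevel S k := Set.mem_iUnion

theorem mem_algebraicDiagonal (hS : IsCuntzFamily S) {x : A} :
    x ∈ hS.algebraicDiagonal ↔ ∃ k, x ∈ cuntzDiagonalLevel S k := Set.mem_iUnion

/-- The core as a closed star subalgebra. -/
noncomputable def coreAlgebra (hS : IsCuntzFamily S) : StarSubalgebra ℂ A :=
  hS.algebraicCore.topologicalClosure

/-- The diagonal as a closed star subalgebra. -/
noncomputable def diagonalAlgebra (hS : IsCuntzFamily S) : StarSubalgebra ℂ A :=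
  hS.algebraicDiagonal.topologicalClosure

theorem mem_coreAlgebra (hS : IsCuntzFamily S) {x : A} :
    x ∈ hS.coreAlgebra ↔ x ∈ closure (hS.algebraicCore : Set A) := Iff.rfl

theorem mem_diagonalAlgebra (hS : IsCuntzFamily S) {x : A} :
    x ∈ hS.diagonalAlgebra ↔ x ∈ closure (hS.algebraicDiagonal : Set A) := Iff.rfl

theorem diagonalAlgebra_le_coreAlgebra (hS : IsCuntzFamily S) :
    hS.diagonalAlgebra ≤ hS.coreAlgebra := by
  apply closure_mono
  exact Set.iUnion_mono fun k => diagonalLevel_le_coreLevel k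

theorem conj_mem_algebraicCore (hS : IsCuntzFamily S) {x : A} (hx : x ∈ hS.algebraicCore)
    (i j : Fin n) : S i * x * star (S j) ∈ hS.algebraicCore := by
  obtain ⟨k, hk⟩ := hS.mem_algebraicCore.1 hx
  exact hS.mem_algebraicCore.2 ⟨k + 1, conj_mem_coreLevel hk i j⟩

theorem corner_mem_algebraicCore (hS : IsCuntzFamily S) {x : A} (hx : x ∈ hS.algebraicCore)
    (i j : Fin n) : star (S i) * x * S j ∈ hS.algebraicCore := by
  obtain ⟨k, hk⟩ := hS.mem_algebraicCore.1 hx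
  exact hS.mem_algebraicCore.2
    ⟨k, hS.mem_coreLevel_succ.1 (hS.coreLevel_le_succ k hk) i j⟩

theorem conj_mem_coreAlgebra (hS : IsCuntzFamily S) {x : A} (hx : x ∈ hS.coreAlgebra)
    (i j : Fin n) : S i * x * star (S j) ∈ hS.coreAlgebra :=
  map_mem_closure (f := fun x => S i * x * star (S j)) (by fun_prop) hx
    fun _ h => hS.conj_mem_algebraicCore h i j

theorem conj_mem_diagonalAlgebra (hS : IsCuntzFamily S) {x : A} (hx : x ∈ hS.diagonalAlgebra)
    (i : Fin n) : S i * x * star (S i) ∈ hS.diagonalAlgebra := by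
  refine map_mem_closure (f := fun x => S i * x * star (S i)) (by fun_prop) hx fun x h => ?_
  obtain ⟨k, hk⟩ := hS.mem_algebraicDiagonal.1 h
  exact hS.mem_algebraicDiagonal.2 ⟨k + 1, conj_mem_diagonalLevel hk i⟩

theorem corner_mem_diagonalAlgebra (hS : IsCuntzFamily S) {x : A} (hx : x ∈ hS.diagonalAlgebra)
    (i : Fin n) : star (S i) * x * S i ∈ hS.diagonalAlgebra := by
  refine map_mem_closure (f := fun x => star (S i) * x * S i) (by fun_prop) hx fun x h => ?_
  obtain ⟨k, hk⟩ := hS.mem_algebraicDiagonal.1 h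
  exact hS.mem_algebraicDiagonal.2
    ⟨k, (hS.mem_diagonalLevel_succ.1 (hS.diagonalLevel_le_succ k hk)).1 i⟩

theorem shift_mem_diagonalAlgebra (hS : IsCuntzFamily S) {x : A} (hx : x ∈ hS.diagonalAlgebra) :
    hS.shift x ∈ hS.diagonalAlgebra := by
  rw [shift_apply]
  exact sum_mem fun i _ => hS.conj_mem_diagonalAlgebra hx i

theorem shiftPow_mem_diagonalAlgebra (hS : IsCuntzFamily S) (k : ℕ) {x : A}
    (hx : x ∈ hS.diagonalAlgebra) : hS.shiftPow k x ∈ hS.diagonalAlgebra := by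
  induction k with
  | zero => exact hx
  | succ k ih => exact hS.shift_mem_diagonalAlgebra ih

theorem commute_of_mem_diagonalAlgebra (hS : IsCuntzFamily S) {x y : A}
    (hx : x ∈ hS.diagonalAlgebra) (hy : y ∈ hS.diagonalAlgebra) : x * y = y * x := by
  have hc : IsClosed {p : A × A | p.1 * p.2 = p.2 * p.1} :=
    isClosed_eq (by fun_prop) (by fun_prop)
  have hxy : (x, y) ∈ closure ((hS.algebraicDiagonal : Set A) ×ˢ (hS.algebraicDiagonal : Set A)) := by
    rw [closure_prod_eq]
    exact ⟨hx, hy⟩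
  refine closure_minimal (fun p hp => ?_) hc hxy
  obtain ⟨k, hk⟩ := hS.mem_algebraicDiagonal.1 hp.1
  obtain ⟨l, hl⟩ := hS.mem_algebraicDiagonal.1 hp.2
  exact hS.commute_of_mem_diagonalLevel
    (hS.diagonalLevel_mono (le_max_left k l) hk) (hS.diagonalLevel_mono (le_max_right k l) hl)

end Levels

open Filter Topology

/-! ### The conditional expectation onto the core as a limit of compressions. -/

section Compression

variable {A : Type*} [CStarAlgebra A] {n : ℕ} {S : Fin n → A}

theorem star_pow_mul_pow_mul (hS : IsCuntzFamily S) (d : ℕ) (i : Fin n) (x : A) :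
    star (S i ^ d) * (S i ^ d * x) = x := by
  rw [← mul_assoc, hS.star_pow_mul_pow, one_mul]

/-- The word `i^m j` does not overlap itself: displaced by `d` with `0 < d ≤ m`, its final `j` meets
an `i`. -/
theorem star_mul_shiftPow_eq_zero (hS : IsCuntzFamily S) {i j : Fin n} (hij : i ≠ j) {d m : ℕ}
    (hd : d ≠ 0) (hdm : d ≤ m) :
    star (S i ^ m * S j) * hS.shiftPow d (S i ^ m * S j) = 0 := by
  obtain ⟨e, rfl⟩ := Nat.exists_eq_add_of_le hdm
  obtain ⟨d, rfl⟩ := Nat.exists_eq_succ_of_ne_zero hd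
  have h1 : star (S i ^ (d + 1 + e) * S j) = star (S j) * star (S i ^ e) * star (S i ^ (d + 1)) := by
    rw [pow_add]
    simp only [star_mul, mul_assoc]
  rw [h1, mul_assoc, hS.star_pow_mul_shiftPow, add_comm (d + 1) e, pow_add]
  simp only [mul_assoc]
  rw [hS.star_pow_mul_pow_mul, pow_succ']
  simp only [← mul_assoc]
  rw [hS.orthogonal j i hij.symm]
  simp

/-- Isometries commuting with the level `a` of the core, such that distinct ones have orthogonal
ranges as long as their indices differ by at most `m`. -/
noncomputable def probe (hS : IsCuntzFamily S) (i j : Fin n) (a m : ℕ) : A :=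
  hS.shiftPow a (S i ^ m * S j)

theorem star_probe_mul_probe (hS : IsCuntzFamily S) {i j : Fin n} (hij : i ≠ j) {a b m : ℕ}
    (hab : a ≤ b + m) (hba : b ≤ a + m) :
    star (hS.probe i j a m) * hS.probe i j b m = if a = b then 1 else 0 := by
  unfold probe
  rw [← map_star]
  rcases lt_trichotomy a b with h | rfl | h
  · obtain ⟨d, rfl⟩ := Nat.exists_eq_add_of_le h.le
    rw [hS.shiftPow_add, ← map_mul, hS.star_mul_shiftPow_eq_zero hij (by lia) (by lia), map_zero,
      if_neg (by lia)]
  · rw [if_pos rfl, ← map_mul, star_mul, mul_assoc, hS.star_pow_mul_pow_mul, hS.isometry, map_one]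
  · obtain ⟨d, rfl⟩ := Nat.exists_eq_add_of_le h.le
    have := congrArg star (hS.star_mul_shiftPow_eq_zero hij (d := d) (m := m) (by lia) (by lia))
    rw [star_mul, star_star, star_zero, ← map_star] at this
    rw [hS.shiftPow_add, ← map_mul, this, map_zero, if_neg (by lia)]

theorem star_probe_mul_self (hS : IsCuntzFamily S) {i j : Fin n} (hij : i ≠ j) (a m : ℕ) :
    star (hS.probe i j a m) * hS.probe i j a m = 1 := by
  simp [hS.star_probe_mul_probe hij (Nat.le_add_right a m) (Nat.le_add_right a m)]

/-- The left probe commutes past `y`, and `S_i^d` raises the index of the right probe from `b` to `b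
+ d`; orthogonality of the probes then decides. -/
theorem compress_mul_pow (hS : IsCuntzFamily S) {i j : Fin n} (hij : i ≠ j) {a b m d k : ℕ}
    {y : A} (hy : y ∈ cuntzCoreLevel S k) (hka : k ≤ a) (hab : a ≤ b + d + m)
    (hba : b + d ≤ a + m) :
    star (hS.probe i j a m) * (y * S i ^ d) * hS.probe i j b m
      = if a = b + d then y * S i ^ d else 0 := by
  have h1 : star (hS.probe i j a m) * y = y * star (hS.probe i j a m) := by
    rw [probe, ← map_star, hS.shiftPow_commute hka hy]
  have h2 : S i ^ d * hS.probe i j b m = hS.probe i j (b + d) m * S i ^ d := by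
    rw [probe, probe, add_comm b d, hS.shiftPow_add, hS.shiftPow_mul_pow]
  rw [← mul_assoc, h1, mul_assoc, mul_assoc, h2, ← mul_assoc (star _),
    hS.star_probe_mul_probe hij hab hba]
  split_ifs <;> simp

theorem compress_star_pow_mul (hS : IsCuntzFamily S) {i j : Fin n} (hij : i ≠ j) {a b m d k : ℕ}
    {y : A} (hy : y ∈ cuntzCoreLevel S k) (hkb : k ≤ b) (hba : b ≤ a + d + m)
    (hab : a + d ≤ b + m) :
    star (hS.probe i j a m) * (star (S i ^ d) * y) * hS.probe i j b m
      = if b = a + d then star (S i ^ d) * y else 0 := by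
  have := congrArg star
    (hS.compress_mul_pow hij (hS.star_mem_coreLevel hy) hkb hba hab)
  simpa [mul_assoc, apply_ite (star : A → A)] using this

/-- The linear span of the homogeneous elements `y S_i^d` and `(S_i*)^d y` with `y` in the
algebraic core. -/
noncomputable def homogeneousSpan (hS : IsCuntzFamily S) (i : Fin n) : Submodule ℂ A :=
  Submodule.span ℂ ({x | ∃ d : ℕ, ∃ y ∈ hS.algebraicCore, x = y * S i ^ d} ∪
    {x | ∃ d : ℕ, ∃ y ∈ hS.algebraicCore, x = star (S i ^ d) * y})

theorem mul_pow_mem (hS : IsCuntzFamily S) (i : Fin n) (d : ℕ) {y : A}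
    (hy : y ∈ hS.algebraicCore) : y * S i ^ d ∈ hS.homogeneousSpan i :=
  Submodule.subset_span (Or.inl ⟨d, y, hy, rfl⟩)

theorem star_pow_mul_mem (hS : IsCuntzFamily S) (i : Fin n) (d : ℕ) {y : A}
    (hy : y ∈ hS.algebraicCore) : star (S i ^ d) * y ∈ hS.homogeneousSpan i :=
  Submodule.subset_span (Or.inr ⟨d, y, hy, rfl⟩)

theorem shift_mem_algebraicCore (hS : IsCuntzFamily S) {x : A} (hx : x ∈ hS.algebraicCore) :
    hS.shift x ∈ hS.algebraicCore := by
  rw [shift_apply]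
  exact sum_mem fun i _ => hS.conj_mem_algebraicCore hx i i

theorem shiftPow_mem_algebraicCore (hS : IsCuntzFamily S) (k : ℕ) {x : A}
    (hx : x ∈ hS.algebraicCore) : hS.shiftPow k x ∈ hS.algebraicCore := by
  induction k with
  | zero => exact hx
  | succ k ih => exact hS.shift_mem_algebraicCore ih

theorem generator_mul_star_mem (hS : IsCuntzFamily S) (i j : Fin n) :
    S i * star (S j) ∈ hS.algebraicCore := by
  simpa using hS.conj_mem_algebraicCore (one_mem _) i j

theorem generator_mul_mem_homogeneousSpan (hS : IsCuntzFamily S) (i l : Fin n) {x : A}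
    (hx : x ∈ hS.homogeneousSpan i) : S l * x ∈ hS.homogeneousSpan i := by
  have core {y : A} (hy : y ∈ hS.algebraicCore) (d : ℕ) :
      S l * (y * S i ^ d) ∈ hS.homogeneousSpan i := by
    -- Inserting `S_i* S_i = 1` returns the coefficient to the core and raises the degree by one.
    have : S l * (y * S i ^ d) = (S l * y * star (S i)) * S i ^ (d + 1) := by
      simp only [mul_assoc, pow_succ', hS.star_mul_cancel]
    rw [this]
    exact hS.mul_pow_mem i _ (hS.conj_mem_algebraicCore hy l i)
  induction hx using Submodule.span_induction with
  | mem x h =>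
    obtain ⟨d, y, hy, rfl⟩ | ⟨d, y, hy, rfl⟩ := h
    · exact core hy d
    · cases d with
      | zero => simpa using core hy 0
      | succ d =>
        have : S l * (star (S i ^ (d + 1)) * y)
            = star (S i ^ d) * (hS.shiftPow d (S l * star (S i)) * y) := by
          rw [← mul_assoc (star _), hS.star_pow_mul_shiftPow, pow_succ, star_mul]
          simp only [mul_assoc]
        rw [this]
        exact hS.star_pow_mul_mem i d
          (mul_mem (hS.shiftPow_mem_algebraicCore d (hS.generator_mul_star_mem l i)) hy)
  | zero => simp
  | add x y _ _ hx hy => simpa [mul_add] using add_mem hx hy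
  | smul c x _ hx => simpa using Submodule.smul_mem _ c hx

theorem star_generator_mul_mem_homogeneousSpan (hS : IsCuntzFamily S) (i l : Fin n) {x : A}
    (hx : x ∈ hS.homogeneousSpan i) : star (S l) * x ∈ hS.homogeneousSpan i := by
  have pow_conj_mem (d : ℕ) {z : A} (hz : z ∈ hS.algebraicCore) :
      S i ^ d * z * star (S i ^ d) ∈ hS.algebraicCore := by
    induction d with
    | zero => simpa using hz
    | succ d ih =>
      have := hS.conj_mem_algebraicCore ih i i
      simpa [pow_succ', star_mul, mul_assoc] using this
  have core {y : A} (hy : y ∈ hS.algebraicCore) (d : ℕ) :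
      star (S l) * (star (S i ^ d) * y) ∈ hS.homogeneousSpan i := by
    have : star (S l) * (star (S i ^ d) * y) = star (S i ^ (d + 1)) *
        ((S i ^ d * (S i * star (S l)) * star (S i ^ d)) * y) := by
      rw [pow_succ, star_mul]
      simp only [mul_assoc]
      rw [hS.star_pow_mul_pow_mul, hS.star_mul_cancel]
    rw [this]
    exact hS.star_pow_mul_mem i _
      (mul_mem (pow_conj_mem d (hS.generator_mul_star_mem i l)) hy)
  induction hx using Submodule.span_induction with
  | mem x h =>
    obtain ⟨d, y, hy, rfl⟩ | ⟨d, y, hy, rfl⟩ := h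
    · cases d with
      | zero => simpa using core hy 0
      | succ d =>
        have : star (S l) * (y * S i ^ (d + 1)) = (star (S l) * y * S i) * S i ^ d := by
          simp only [mul_assoc, pow_succ']
        rw [this]
        exact hS.mul_pow_mem i _ (hS.corner_mem_algebraicCore hy l i)
    · exact core hy d
  | zero => simp
  | add x y _ _ hx hy => simpa [mul_add] using add_mem hx hy
  | smul c x _ hx => simpa using Submodule.smul_mem _ c hx

/-- The span contains `1` and is stable under left multiplication by the generators and their
adjoints, so it contains the dense star algebra they generate. -/
theorem mem_closure_homogeneousSpan (hS : IsCuntzFamily S) (i : Fin n) (x : A) :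
    x ∈ closure (hS.homogeneousSpan i : Set A) := by
  have h1 : x ∈ (StarAlgebra.adjoin ℂ (Set.range S)).topologicalClosure := by
    rw [hS.generates]
    trivial
  refine closure_mono (fun a ha => ?_) h1
  have h2 : a ∈ Algebra.adjoin ℂ (Set.range S ∪ star (Set.range S)) := by
    rwa [← StarAlgebra.adjoin_toSubalgebra]
  suffices h : ∀ z ∈ hS.homogeneousSpan i, a * z ∈ hS.homogeneousSpan i by
    have h3 := h 1 (by simpa using hS.mul_pow_mem i 0 (one_mem _))
    rwa [mul_one] at h3
  clear ha h1
  induction h2 using Algebra.adjoin_induction with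
  | mem a ha =>
    intro z hz
    rcases ha with ⟨l, rfl⟩ | ⟨l, hl⟩
    · exact hS.generator_mul_mem_homogeneousSpan i l hz
    · obtain rfl : star (S l) = a := by rw [hl, star_star]
      exact hS.star_generator_mul_mem_homogeneousSpan i l hz
  | algebraMap c =>
    intro z hz
    rw [← Algebra.smul_def]
    exact Submodule.smul_mem _ c hz
  | add a b _ _ ha hb =>
    intro z hz
    rw [add_mul]
    exact add_mem (ha z hz) (hb z hz)
  | mul a b _ _ ha hb =>
    intro z hz
    rw [mul_assoc]
    exact ha _ (hb z hz)

theorem exists_homogeneousSpan_norm_sub_lt (hS : IsCuntzFamily S) (i : Fin n) (x : A) {ε : ℝ}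
    (hε : 0 < ε) : ∃ p ∈ hS.homogeneousSpan i, ‖x - p‖ < ε := by
  obtain ⟨p, hp, h⟩ := Metric.mem_closure_iff.1 (hS.mem_closure_homogeneousSpan i x) ε hε
  exact ⟨p, hp, by rwa [← dist_eq_norm]⟩

/-- Only the degree-zero part survives. The threshold `k + d` secures both commutation with level
`k` and a word long enough to detect a displacement by `d`. -/
theorem compress_eventually_const (hS : IsCuntzFamily S) {i j : Fin n} (hij : i ≠ j) {p : A}
    (hp : p ∈ hS.homogeneousSpan i) : ∃ q ∈ hS.algebraicCore, ∃ K, ∀ a ≥ K, ∀ m ≥ K,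
      star (hS.probe i j a m) * p * hS.probe i j a m = q := by
  induction hp using Submodule.span_induction with
  | mem p h =>
    obtain ⟨d, y, hy, rfl⟩ | ⟨d, y, hy, rfl⟩ := h
    all_goals
      obtain ⟨k, hk⟩ := hS.mem_algebraicCore.1 hy
      refine ⟨if d = 0 then y else 0, ?_, k + d, fun a ha m hm => ?_⟩
    · split_ifs <;> simp [hy]
    · rw [hS.compress_mul_pow hij hk (by lia) (by lia) (by lia)]
      by_cases hd : d = 0 <;> simp [hd]
    · split_ifs <;> simp [hy]
    · rw [hS.compress_star_pow_mul hij hk (by lia) (by lia) (by lia)]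
      by_cases hd : d = 0 <;> simp [hd]
  | zero => exact ⟨0, zero_mem _, 0, by simp⟩
  | add x y _ _ hx hy =>
    obtain ⟨q, hq, K, hK⟩ := hx
    obtain ⟨r, hr, L, hL⟩ := hy
    refine ⟨q + r, add_mem hq hr, max K L, fun a ha m hm => ?_⟩
    rw [mul_add, add_mul, hK a (by lia) m (by lia), hL a (by lia) m (by lia)]
  | smul c x _ hx =>
    obtain ⟨q, hq, K, hK⟩ := hx
    refine ⟨c • q, SMulMemClass.smul_mem c hq, K, fun a ha m hm => ?_⟩
    rw [mul_smul_comm, smul_mul_assoc, hK a ha m hm]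

theorem norm_compress_le (hS : IsCuntzFamily S) {i j : Fin n} (hij : i ≠ j) (a m : ℕ) (x : A) :
    ‖star (hS.probe i j a m) * x * hS.probe i j a m‖ ≤ ‖x‖ := by
  have h : ‖hS.probe i j a m‖ ≤ 1 := by
    have h1 := CStarRing.norm_star_mul_self (x := hS.probe i j a m)
    rw [hS.star_probe_mul_self hij] at h1
    by_contra! h2
    have h3 : ‖(1 : A)‖ ≤ 1 := by
      nontriviality A
      simp
    nlinarith
  calc ‖star (hS.probe i j a m) * x * hS.probe i j a m‖
      ≤ ‖star (hS.probe i j a m)‖ * ‖x‖ * ‖hS.probe i j a m‖ :=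
        (norm_mul_le _ _).trans (by gcongr; exact norm_mul_le _ _)
    _ ≤ 1 * ‖x‖ * 1 := by
        rw [norm_star]
        gcongr
    _ = ‖x‖ := by ring

theorem compress_sub (hS : IsCuntzFamily S) (i j : Fin n) (a m : ℕ) (x y : A) :
    star (hS.probe i j a m) * (x - y) * hS.probe i j a m
      = star (hS.probe i j a m) * x * hS.probe i j a m
        - star (hS.probe i j a m) * y * hS.probe i j a m := by
  rw [mul_sub, sub_mul]

theorem compress_near (hS : IsCuntzFamily S) {i j : Fin n} (hij : i ≠ j) (x : A) {ε : ℝ}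
    (hε : 0 < ε) : ∃ q ∈ hS.algebraicCore, ∃ K, ∀ a ≥ K, ∀ m ≥ K,
      ‖star (hS.probe i j a m) * x * hS.probe i j a m - q‖ < ε := by
  obtain ⟨p, hp, h⟩ := hS.exists_homogeneousSpan_norm_sub_lt i x hε
  obtain ⟨q, hq, K, hK⟩ := hS.compress_eventually_const hij hp
  refine ⟨q, hq, K, fun a ha m hm => ?_⟩
  rw [← hK a ha m hm, ← compress_sub]
  exact (hS.norm_compress_le hij a m _).trans_lt h

/-- The conditional expectation onto the core, as a limit of compressions. -/
noncomputable def coreExpectation (hS : IsCuntzFamily S) (i j : Fin n) (x : A) : A :=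
  limUnder atTop fun k => star (hS.probe i j k k) * x * hS.probe i j k k

theorem tendsto_coreExpectation (hS : IsCuntzFamily S) {i j : Fin n} (hij : i ≠ j) (x : A) :
    Tendsto (fun k => star (hS.probe i j k k) * x * hS.probe i j k k) atTop
      (𝓝 (hS.coreExpectation i j x)) := by
  refine CauchySeq.tendsto_limUnder (Metric.cauchySeq_iff'.2 fun ε hε => ?_)
  obtain ⟨q, -, K, hK⟩ := hS.compress_near hij x (half_pos hε)
  refine ⟨K, fun k hk => ?_⟩
  have h1 := hK k hk k hk
  have h2 := hK K le_rfl K le_rfl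
  rw [← dist_eq_norm] at h1 h2
  linarith [dist_triangle_right (star (hS.probe i j k k) * x * hS.probe i j k k)
    (star (hS.probe i j K K) * x * hS.probe i j K K) q]

/-- Letting `a` and `m` vary independently is needed for Fejér means, whose probes share `m` but not
`a`. -/
theorem compress_near_coreExpectation (hS : IsCuntzFamily S) {i j : Fin n} (hij : i ≠ j) (x : A)
    {ε : ℝ} (hε : 0 < ε) : ∃ K, ∀ a ≥ K, ∀ m ≥ K,
      ‖star (hS.probe i j a m) * x * hS.probe i j a m - hS.coreExpectation i j x‖ < ε := by
  obtain ⟨q, -, K, hK⟩ := hS.compress_near hij x (half_pos hε)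
  refine ⟨K, fun a ha m hm => ?_⟩
  have h1 : ‖hS.coreExpectation i j x - q‖ ≤ ε / 2 := by
    refine le_of_tendsto ((hS.tendsto_coreExpectation hij x).sub_const q).norm ?_
    filter_upwards [eventually_ge_atTop K] with k hk using (hK k hk k hk).le
  have h2 := hK a ha m hm
  rw [← dist_eq_norm] at h1 h2 ⊢
  linarith [dist_triangle_right (star (hS.probe i j a m) * x * hS.probe i j a m)
    (hS.coreExpectation i j x) q]

theorem coreExpectation_mem (hS : IsCuntzFamily S) {i j : Fin n} (hij : i ≠ j) (x : A) :
    hS.coreExpectation i j x ∈ hS.coreAlgebra := by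
  rw [mem_coreAlgebra, Metric.mem_closure_iff]
  intro ε hε
  obtain ⟨q, hq, K, hK⟩ := hS.compress_near hij x (half_pos hε)
  obtain ⟨L, hL⟩ := hS.compress_near_coreExpectation hij x (half_pos hε)
  refine ⟨q, hq, ?_⟩
  have h1 := hK (max K L) (le_max_left _ _) (max K L) (le_max_left _ _)
  have h2 := hL (max K L) (le_max_right _ _) (max K L) (le_max_right _ _)
  rw [← dist_eq_norm] at h1 h2
  linarith [dist_triangle_left (hS.coreExpectation i j x) q
    (star (hS.probe i j (max K L) (max K L)) * x * hS.probe i j (max K L) (max K L))]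

theorem coreExpectation_sub (hS : IsCuntzFamily S) {i j : Fin n} (hij : i ≠ j) (x y : A) :
    hS.coreExpectation i j (x - y) = hS.coreExpectation i j x - hS.coreExpectation i j y := by
  refine tendsto_nhds_unique (hS.tendsto_coreExpectation hij (x - y)) ?_
  simpa only [compress_sub] using
    (hS.tendsto_coreExpectation hij x).sub (hS.tendsto_coreExpectation hij y)

theorem coreExpectation_add (hS : IsCuntzFamily S) {i j : Fin n} (hij : i ≠ j) (x y : A) :
    hS.coreExpectation i j (x + y) = hS.coreExpectation i j x + hS.coreExpectation i j y := by
  refine tendsto_nhds_unique (hS.tendsto_coreExpectation hij (x + y)) ?_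
  simpa only [mul_add, add_mul] using
    (hS.tendsto_coreExpectation hij x).add (hS.tendsto_coreExpectation hij y)

theorem coreExpectation_smul (hS : IsCuntzFamily S) {i j : Fin n} (hij : i ≠ j) (c : ℂ) (x : A) :
    hS.coreExpectation i j (c • x) = c • hS.coreExpectation i j x := by
  refine tendsto_nhds_unique (hS.tendsto_coreExpectation hij (c • x)) ?_
  simpa only [mul_smul_comm, smul_mul_assoc] using
    (hS.tendsto_coreExpectation hij x).const_smul c

theorem coreExpectation_star (hS : IsCuntzFamily S) {i j : Fin n} (hij : i ≠ j) (x : A) :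
    hS.coreExpectation i j (star x) = star (hS.coreExpectation i j x) := by
  refine tendsto_nhds_unique (hS.tendsto_coreExpectation hij (star x)) ?_
  simpa [mul_assoc] using (hS.tendsto_coreExpectation hij x).star

theorem norm_coreExpectation_le (hS : IsCuntzFamily S) {i j : Fin n} (hij : i ≠ j) (x : A) :
    ‖hS.coreExpectation i j x‖ ≤ ‖x‖ :=
  le_of_tendsto' (hS.tendsto_coreExpectation hij x).norm fun k => hS.norm_compress_le hij k k x

theorem continuous_coreExpectation (hS : IsCuntzFamily S) {i j : Fin n} (hij : i ≠ j) :
    Continuous (hS.coreExpectation i j) := by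
  refine (LipschitzWith.of_dist_le_mul (K := 1) fun x y => ?_).continuous
  rw [dist_eq_norm, dist_eq_norm, ← hS.coreExpectation_sub hij]
  simpa using hS.norm_coreExpectation_le hij (x - y)

theorem coreExpectation_mul_left (hS : IsCuntzFamily S) {i j : Fin n} (hij : i ≠ j) {y : A}
    (hy : y ∈ hS.coreAlgebra) (x : A) :
    hS.coreExpectation i j (y * x) = y * hS.coreExpectation i j x := by
  have hc : IsClosed {y | hS.coreExpectation i j (y * x) = y * hS.coreExpectation i j x} :=
    isClosed_eq ((hS.continuous_coreExpectation hij).comp (by fun_prop)) (by fun_prop)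
  refine closure_minimal (fun y hy => ?_) hc hy
  obtain ⟨k, hk⟩ := hS.mem_algebraicCore.1 hy
  refine tendsto_nhds_unique (hS.tendsto_coreExpectation hij (y * x)) ?_
  refine ((hS.tendsto_coreExpectation hij x).const_mul y).congr' ?_
  filter_upwards [eventually_ge_atTop k] with a ha
  have h1 : star (hS.probe i j a a) * y = y * star (hS.probe i j a a) := by
    rw [probe, ← map_star, hS.shiftPow_commute ha hk]
  rw [← mul_assoc, ← mul_assoc, ← mul_assoc, h1]

theorem coreExpectation_mul_right (hS : IsCuntzFamily S) {i j : Fin n} (hij : i ≠ j) {y : A}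
    (hy : y ∈ hS.coreAlgebra) (x : A) :
    hS.coreExpectation i j (x * y) = hS.coreExpectation i j x * y := by
  have := congrArg star (hS.coreExpectation_mul_left hij (star_mem hy) (star x))
  simpa [← hS.coreExpectation_star hij] using this

theorem coreExpectation_of_mem (hS : IsCuntzFamily S) {i j : Fin n} (hij : i ≠ j) {y : A}
    (hy : y ∈ hS.coreAlgebra) : hS.coreExpectation i j y = y := by
  have h1 : hS.coreExpectation i j 1 = 1 := by
    refine tendsto_nhds_unique (hS.tendsto_coreExpectation hij 1) ?_
    simp [hS.star_probe_mul_self hij]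
  simpa [h1] using hS.coreExpectation_mul_left hij hy 1

theorem coreExpectation_pow (hS : IsCuntzFamily S) {i j : Fin n} (hij : i ≠ j) {d : ℕ}
    (hd : d ≠ 0) : hS.coreExpectation i j (S i ^ d) = 0 := by
  refine tendsto_nhds_unique (hS.tendsto_coreExpectation hij _) (tendsto_const_nhds.congr' ?_)
  filter_upwards [eventually_ge_atTop d] with a ha
  have := hS.compress_mul_pow hij (a := a) (b := a) (m := a) (d := d) (k := 0) (y := 1)
    (mem_coreLevel_zero.2 ⟨1, by simp⟩) (by lia) (by lia) (by lia)
  rw [one_mul, if_neg (by lia)] at this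
  exact this.symm

end Compression

/-! ### Fejér means and faithfulness of the expectation. -/

section Faithful

variable {A : Type*} [CStarAlgebra A] {n : ℕ} {S : Fin n → A}

/-- A Fejér mean, realised as a normalised sum of compressions. -/
noncomputable def fejerMean (hS : IsCuntzFamily S) (i j : Fin n) (N k : ℕ) (x : A) : A :=
  (N : ℂ)⁻¹ • ∑ a ∈ Finset.range N, ∑ b ∈ Finset.range N,
    star (hS.probe i j (k + a) k) * x * hS.probe i j (k + b) k

theorem fejerMean_add (hS : IsCuntzFamily S) (i j : Fin n) (N k : ℕ) (x y : A) :
    hS.fejerMean i j N k (x + y) = hS.fejerMean i j N k x + hS.fejerMean i j N k y := by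
  simp only [fejerMean, mul_add, add_mul, Finset.sum_add_distrib, smul_add]

theorem fejerMean_smul (hS : IsCuntzFamily S) (i j : Fin n) (N k : ℕ) (c : ℂ) (x : A) :
    hS.fejerMean i j N k (c • x) = c • hS.fejerMean i j N k x := by
  simp only [fejerMean, mul_smul_comm, smul_mul_assoc, ← Finset.smul_sum, smul_comm c]

/-- The mean is `N⁻¹ V* x V`, where `V` is the sum of `N` isometries with orthogonal ranges, so that
`V* V = N`. -/
theorem norm_fejerMean_le (hS : IsCuntzFamily S) {i j : Fin n} (hij : i ≠ j) {N k : ℕ}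
    (hNk : N ≤ k) (x : A) : ‖hS.fejerMean i j N k x‖ ≤ ‖x‖ := by
  set V : A := ∑ a ∈ Finset.range N, hS.probe i j (k + a) k with hV
  have hsum (z : A) : ∑ a ∈ Finset.range N, ∑ b ∈ Finset.range N,
      star (hS.probe i j (k + a) k) * z * hS.probe i j (k + b) k = star V * z * V := by
    rw [hV, star_sum, Finset.sum_mul, Finset.sum_mul]
    simp only [Finset.mul_sum]
  have hVV : star V * V = (N : ℂ) • (1 : A) := by
    have h := hsum 1
    rw [mul_one] at h
    rw [← h]
    have h1 : ∀ a ∈ Finset.range N, ∑ b ∈ Finset.range N,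
        star (hS.probe i j (k + a) k) * 1 * hS.probe i j (k + b) k = (1 : A) := by
      intro a ha
      rw [Finset.sum_eq_single a]
      · rw [mul_one, hS.star_probe_mul_self hij]
      · intro b hb hba
        rw [Finset.mem_range] at ha hb
        rw [mul_one, hS.star_probe_mul_probe hij (by lia) (by lia), if_neg (by lia)]
      · exact fun h => (h ha).elim
    rw [Finset.sum_congr rfl h1]
    simp [Nat.cast_smul_eq_nsmul]
  have hn : ‖V‖ * ‖V‖ ≤ N := by
    rw [← CStarRing.norm_star_mul_self, hVV, norm_smul]
    have : ‖(1 : A)‖ ≤ 1 := by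
      nontriviality A
      simp
    simpa using mul_le_mul_of_nonneg_left this (Nat.cast_nonneg (α := ℝ) N)
  rw [fejerMean, hsum, norm_smul]
  rcases Nat.eq_zero_or_pos N with rfl | hN
  · simp
  have hN' : (0 : ℝ) < N := by exact_mod_cast hN
  rw [norm_inv, Complex.norm_natCast, inv_mul_le_iff₀ hN']
  calc ‖star V * x * V‖ ≤ ‖V‖ * ‖x‖ * ‖V‖ := by
        refine (norm_mul_le _ _).trans ?_
        gcongr
        exact (norm_mul_le _ _).trans (by rw [norm_star])
    _ = (‖V‖ * ‖V‖) * ‖x‖ := by ring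
    _ ≤ N * ‖x‖ := by gcongr

theorem sum_ite_eq_add (N d : ℕ) (z : A) :
    ∑ a ∈ Finset.range N, ∑ b ∈ Finset.range N, (if a = b + d then z else 0)
      = ((N - d : ℕ) : ℂ) • z := by
  rw [Finset.sum_comm]
  have h1 : ∀ b ∈ Finset.range N, (∑ a ∈ Finset.range N, if a = b + d then z else 0)
      = if b < N - d then z else 0 := by
    intro b hb
    rw [Finset.sum_ite_eq']
    simp only [Finset.mem_range]
    congr 1
    simp only [eq_iff_iff]
    lia
  rw [Finset.sum_congr rfl h1, ← Finset.sum_filter, Finset.sum_const]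
  have h2 : (Finset.range N).filter (· < N - d) = Finset.range (N - d) := by
    ext b
    simp only [Finset.mem_filter, Finset.mem_range]
    lia
  rw [h2, Finset.card_range, Nat.cast_smul_eq_nsmul]

theorem tendsto_fejer_coefficient (d : ℕ) (z : A) :
    Tendsto (fun N : ℕ => (N : ℂ)⁻¹ • ((N - d : ℕ) : ℂ) • z) atTop (𝓝 z) := by
  have h1 : Tendsto (fun N : ℕ => (1 : ℂ) - d * (N : ℂ)⁻¹) atTop (𝓝 (1 - d * 0)) :=
    tendsto_const_nhds.sub (tendsto_inv_atTop_nhds_zero_nat.const_mul _)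
  have h2 := h1.smul_const z
  rw [mul_zero, sub_zero, one_smul] at h2
  refine h2.congr' ?_
  filter_upwards [eventually_ge_atTop (d + 1)] with N hN
  have hN0 : (N : ℂ) ≠ 0 := by
    rw [Nat.cast_ne_zero]
    lia
  rw [smul_smul, Nat.cast_sub (by lia)]
  congr 1
  field_simp

/-- A term of degree `±d` survives for the pairs of indices differing by `d` in the right direction.
There are `N - d` of them, so it acquires the Fejér coefficient `(N - d) / N`. -/
theorem fejerMean_eventually_const (hS : IsCuntzFamily S) {i j : Fin n} (hij : i ≠ j) {p : A}
    (hp : p ∈ hS.homogeneousSpan i) : ∃ f : ℕ → A, Tendsto f atTop (𝓝 p) ∧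
      ∀ N, ∃ K, ∀ k ≥ K, hS.fejerMean i j N k p = f N := by
  induction hp using Submodule.span_induction with
  | mem p h =>
    obtain ⟨d, y, hy, rfl⟩ | ⟨d, y, hy, rfl⟩ := h
    all_goals
      obtain ⟨l, hl⟩ := hS.mem_algebraicCore.1 hy
      refine ⟨_, tendsto_fejer_coefficient d _, fun N => ⟨l + d + N, fun k hk => ?_⟩⟩
      rw [fejerMean, ← sum_ite_eq_add]
      congr 1
    · refine Finset.sum_congr rfl fun a ha => Finset.sum_congr rfl fun b hb => ?_
      rw [Finset.mem_range] at ha hb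
      rw [hS.compress_mul_pow hij hl (by lia) (by lia) (by lia)]
      simp only [add_assoc, add_right_inj]
    · rw [Finset.sum_comm]
      refine Finset.sum_congr rfl fun a ha => Finset.sum_congr rfl fun b hb => ?_
      rw [Finset.mem_range] at ha hb
      rw [hS.compress_star_pow_mul hij hl (by lia) (by lia) (by lia)]
      simp only [add_assoc, add_right_inj]
  | zero => exact ⟨0, tendsto_const_nhds, fun N => ⟨0, fun k _ => by simp [fejerMean]⟩⟩
  | add x y _ _ hx hy =>
    obtain ⟨f, hf, hK⟩ := hx
    obtain ⟨g, hg, hL⟩ := hy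
    refine ⟨f + g, hf.add hg, fun N => ?_⟩
    obtain ⟨K, hK⟩ := hK N
    obtain ⟨L, hL⟩ := hL N
    refine ⟨max K L, fun k hk => ?_⟩
    rw [fejerMean_add, hK k (by lia), hL k (by lia), Pi.add_apply]
  | smul c x _ hx =>
    obtain ⟨f, hf, hK⟩ := hx
    refine ⟨c • f, hf.const_smul c, fun N => ?_⟩
    obtain ⟨K, hK⟩ := hK N
    exact ⟨K, fun k hk => by rw [fejerMean_smul, hK k hk, Pi.smul_apply]⟩

/-- The conditional expectation onto the core is faithful. -/
theorem eq_zero_of_coreExpectation_eq_zero (hS : IsCuntzFamily S) {i j : Fin n} (hij : i ≠ j)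
    {y : A} (hy : hS.coreExpectation i j (star y * y) = 0) : y = 0 := by
  -- The four errors: approximation by `p`, the Fejér mean of `p` against `p`, the mean of the
  -- approximation error, and the mean of `y* y`.
  suffices h : ∀ ε > 0, ‖star y * y‖ ≤ 4 * ε by
    rw [← CStarRing.star_mul_self_eq_zero_iff, ← norm_le_zero_iff]
    refine le_of_forall_pos_le_add fun ε hε => ?_
    linarith [h (ε / 4) (by positivity)]
  intro ε hε
  obtain ⟨p, hp, hyp⟩ := hS.exists_homogeneousSpan_norm_sub_lt i (star y * y) hε
  obtain ⟨f, hf, hfN⟩ := hS.fejerMean_eventually_const hij hp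
  obtain ⟨N, hN, hN1⟩ := ((hf.eventually (Metric.ball_mem_nhds p hε)).and
    (eventually_ge_atTop 1)).exists
  have hN0 : (0 : ℝ) < N := by exact_mod_cast hN1
  obtain ⟨K, hK⟩ := hfN N
  obtain ⟨L, hL⟩ := hS.compress_near_coreExpectation hij (star y * y) (div_pos hε hN0)
  set k := max (max K L) N
  have h1 : ‖f N - p‖ < ε := by
    rw [← dist_eq_norm]
    exact hN
  have h2 : ‖hS.fejerMean i j N k (star y * y)‖ ≤ ε := by
    -- The vanishing expectation makes the diagonal compressions of `y* y` small, and positivity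
    -- passes this to the off-diagonal ones. The `N²` terms of size `ε / N`, divided by `N`, then
    -- add up to at most `ε`.
    have hs (a : ℕ) : ‖y * hS.probe i j (k + a) k‖ * ‖y * hS.probe i j (k + a) k‖ ≤ ε / N := by
      rw [← CStarRing.norm_star_mul_self]
      have := hL (k + a) (by lia) k (by lia)
      rw [hy, sub_zero] at this
      simpa [mul_assoc] using this.le
    have ht (a b : ℕ) : ‖star (hS.probe i j (k + a) k) * (star y * y) * hS.probe i j (k + b) k‖
        ≤ ε / N := by
      have h3 : star (hS.probe i j (k + a) k) * (star y * y) * hS.probe i j (k + b) k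
          = star (y * hS.probe i j (k + a) k) * (y * hS.probe i j (k + b) k) := by
        simp [mul_assoc]
      rw [h3]
      refine (norm_mul_le _ _).trans ?_
      rw [norm_star]
      nlinarith [hs a, hs b, sq_nonneg
        (‖y * hS.probe i j (k + a) k‖ - ‖y * hS.probe i j (k + b) k‖)]
    rw [fejerMean, norm_smul, norm_inv, Complex.norm_natCast, inv_mul_le_iff₀ hN0]
    refine (norm_sum_le_of_le _ fun a _ => norm_sum_le_of_le _ fun b _ => ht a b).trans ?_
    simp only [Finset.sum_const, Finset.card_range, nsmul_eq_mul]
    rw [mul_div_cancel₀ _ hN0.ne']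
  have h3 : ‖hS.fejerMean i j N k (p - star y * y)‖ ≤ ε :=
    (hS.norm_fejerMean_le hij (by lia) _).trans (by rw [norm_sub_rev]; exact hyp.le)
  have h4 : f N = hS.fejerMean i j N k (p - star y * y) + hS.fejerMean i j N k (star y * y) := by
    rw [← fejerMean_add, sub_add_cancel, hK k (by lia)]
  have h5 : star y * y = (star y * y - p) - (f N - p)
      + (hS.fejerMean i j N k (p - star y * y) + hS.fejerMean i j N k (star y * y)) := by
    rw [← h4]
    abel
  rw [h5]
  have h6 := norm_add_le ((star y * y - p) - (f N - p))
    (hS.fejerMean i j N k (p - star y * y) + hS.fejerMean i j N k (star y * y))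
  have h7 := norm_sub_le (star y * y - p) (f N - p)
  have h8 := norm_add_le (hS.fejerMean i j N k (p - star y * y))
    (hS.fejerMean i j N k (star y * y))
  linarith

end Faithful

/-! ### Simplicity and the universal property. -/

section Simple

variable {A B : Type*} [CStarAlgebra A] [CStarAlgebra B] {n : ℕ} {S : Fin n → A}

theorem continuous_starAlgHom (π : A →⋆ₐ[ℂ] B) : Continuous π :=
  AddMonoidHomClass.continuous_of_bound π 1 fun x => by
    simpa using NonUnitalStarAlgHom.norm_apply_le π x

theorem eq_zero_of_mem_coreLevel [Nontrivial B] (hS : IsCuntzFamily S) (π : A →⋆ₐ[ℂ] B) {k : ℕ}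
    {x : A} (hx : x ∈ cuntzCoreLevel S k) (h : π x = 0) : x = 0 := by
  induction k generalizing x with
  | zero =>
    obtain ⟨c, rfl⟩ := mem_coreLevel_zero.1 hx
    rw [AlgHomClass.commutes, map_eq_zero_iff _ (algebraMap ℂ B).injective] at h
    rw [h, map_zero]
  | succ k ih =>
    refine hS.ext_corner fun i j => ?_
    rw [ih (hS.mem_coreLevel_succ.1 hx i j) (by simp [h])]
    simp

/-- Each level is finite-dimensional, hence a C*-algebra, and injective homomorphisms of C*-algebras
are isometric. -/
theorem norm_map_of_mem_algebraicCore [Nontrivial B] (hS : IsCuntzFamily S) (π : A →⋆ₐ[ℂ] B)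
    {x : A} (hx : x ∈ hS.algebraicCore) : ‖π x‖ = ‖x‖ := by
  obtain ⟨k, hk⟩ := hS.mem_algebraicCore.1 hx
  have : IsClosed (hS.coreLevelAlgebra k : Set A) := hS.isClosed_coreLevelAlgebra k
  have hinj : Function.Injective (π.comp (hS.coreLevelAlgebra k).subtype) := by
    rw [injective_iff_map_eq_zero]
    intro z hz
    exact Subtype.ext (hS.eq_zero_of_mem_coreLevel π z.2 hz)
  exact NonUnitalStarAlgHom.norm_map (π.comp (hS.coreLevelAlgebra k).subtype) hinj ⟨x, hk⟩

theorem norm_map_of_mem_coreAlgebra [Nontrivial B] (hS : IsCuntzFamily S) (π : A →⋆ₐ[ℂ] B)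
    {x : A} (hx : x ∈ hS.coreAlgebra) : ‖π x‖ = ‖x‖ := by
  have hπ : Continuous π := continuous_starAlgHom π
  exact closure_minimal (fun y hy => hS.norm_map_of_mem_algebraicCore π hy)
    (isClosed_eq (by fun_prop) continuous_norm) hx

/-- A C*-algebra generated by a Cuntz family with at least two generators is simple. -/
theorem injective_of_nontrivial [Nontrivial B] (hS : IsCuntzFamily S) (hn : 2 ≤ n)
    (π : A →⋆ₐ[ℂ] B) : Function.Injective π := by
  rw [injective_iff_map_eq_zero]
  intro x hx
  have hij : (⟨0, by lia⟩ : Fin n) ≠ ⟨1, by lia⟩ := by simp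
  refine hS.eq_zero_of_coreExpectation_eq_zero hij ?_
  -- `E(x* x)` is a limit of compressions of `x* x`, all killed by `π`, while `π` is isometric on
  -- the core.
  rw [← norm_eq_zero, ← hS.norm_map_of_mem_coreAlgebra π (hS.coreExpectation_mem hij _),
    norm_eq_zero]
  have hπ : Continuous π := continuous_starAlgHom π
  refine tendsto_nhds_unique
    ((hπ.tendsto _).comp (hS.tendsto_coreExpectation hij (star x * x))) ?_
  refine tendsto_const_nhds.congr fun k => ?_
  simp [hx]

theorem hom_ext (hS : IsCuntzFamily S) {f g : A →⋆ₐ[ℂ] B} (h : ∀ i, f (S i) = g (S i)) :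
    f = g := by
  have hf : Continuous f := continuous_starAlgHom f
  have hg : Continuous g := continuous_starAlgHom g
  have h1 : (StarAlgebra.adjoin ℂ (Set.range S)) ≤ StarAlgHom.equalizer f g :=
    StarAlgebra.adjoin_le (by rintro _ ⟨i, rfl⟩; exact h i)
  ext x
  have hx : x ∈ (StarAlgebra.adjoin ℂ (Set.range S)).topologicalClosure := by
    rw [hS.generates]
    trivial
  exact closure_minimal (fun y hy => h1 hy) (isClosed_eq hf hg) hx

theorem surjective_of_generators_mem (hS : IsCuntzFamily S) {f : B →⋆ₐ[ℂ] A}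
    (hf : Function.Injective f) (h : ∀ i, S i ∈ Set.range f) : Function.Surjective f := by
  intro x
  have hx : x ∈ (StarAlgebra.adjoin ℂ (Set.range S)).topologicalClosure := by
    rw [hS.generates]
    trivial
  have hc : IsClosed (Set.range f) :=
    (NonUnitalStarAlgHom.isometry f hf).isClosedEmbedding.isClosed_range
  have h1 : StarAlgebra.adjoin ℂ (Set.range S) ≤ f.range :=
    StarAlgebra.adjoin_le (by rintro _ ⟨i, rfl⟩; exact h i)
  exact closure_minimal (fun y hy => h1 hy) hc hx

/-- The universal property of the Cuntz algebra. -/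
theorem exists_hom [Nontrivial A] (hS : IsCuntzFamily S) (hn : 2 ≤ n) {T : Fin n → B}
    (hT : ∀ i, star (T i) * T i = 1) (hT' : ∀ i j, i ≠ j → star (T i) * T j = 0)
    (hT1 : ∑ i, T i * star (T i) = 1) : ∃ f : A →⋆ₐ[ℂ] B, ∀ i, f (S i) = T i := by
  -- `C` will be the graph of the required homomorphism: it is itself generated by a Cuntz family,
  -- so by simplicity its projection to `A` is an isomorphism.
  set C := (StarAlgebra.adjoin ℂ (Set.range fun i => (S i, T i))).topologicalClosure with hC
  have hclosed : IsClosed (C : Set (A × B)) := StarSubalgebra.isClosed_topologicalClosure _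
  let R : Fin n → C := fun i => ⟨(S i, T i), subset_closure
    (StarAlgebra.subset_adjoin ℂ _ ⟨i, rfl⟩)⟩
  have hR : IsCuntzFamily R := by
    refine ⟨fun i => ?_, fun i j hij => ?_, ?_, ?_⟩
    · exact Subtype.ext (Prod.ext (hS.isometry i) (hT i))
    · exact Subtype.ext (Prod.ext (hS.orthogonal i j hij) (hT' i j hij))
    · refine Subtype.ext ?_
      rw [AddSubmonoidClass.coe_finsetSum]
      refine Prod.ext ?_ ?_
      · rw [Prod.fst_sum]
        exact hS.sum_range
      · rw [Prod.snd_sum]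
        exact hT1
    · rw [eq_top_iff]
      intro x _
      change x ∈ closure (StarAlgebra.adjoin ℂ (Set.range R) : Set C)
      rw [closure_subtype]
      have h1 : (Subtype.val '' (StarAlgebra.adjoin ℂ (Set.range R) : Set C) : Set (A × B))
          = StarAlgebra.adjoin ℂ (Set.range fun i => (S i, T i)) := by
        have h2 := StarAlgHom.map_adjoin C.subtype (Set.range R)
        rw [← Set.range_comp] at h2
        exact congrArg (fun D : StarSubalgebra ℂ (A × B) => (D : Set (A × B))) h2
      rw [h1]
      exact x.2
  let p : C →⋆ₐ[ℂ] A := (StarAlgHom.fst ℂ A B).comp C.subtype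
  have hp : Function.Injective p := hR.injective_of_nontrivial hn p
  have hp' : Function.Surjective p := hS.surjective_of_generators_mem hp fun i => ⟨R i, rfl⟩
  let e : C ≃⋆ₐ[ℂ] A := StarAlgEquiv.ofBijective p ⟨hp, hp'⟩
  refine ⟨((StarAlgHom.snd ℂ A B).comp C.subtype).comp (e.symm : A →⋆ₐ[ℂ] C), fun i => ?_⟩
  have : e.symm (S i) = R i := by
    rw [← e.apply_symm_apply (S i)]
    exact e.injective (e.apply_symm_apply _ |>.trans (e.apply_symm_apply _))
  change (e.symm (S i) : A × B).2 = T i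
  rw [this]

end Simple

/-! ### The diagonal is maximal abelian. -/

section Masa

variable {A : Type*} [CStarAlgebra A] {n : ℕ} {S : Fin n → A}

/-- The norm of a block-diagonal matrix is controlled by its blocks: `x* x` has blocks `a_i* a_i ≤
c²`. -/
theorem norm_sum_conj_le (hS : IsCuntzFamily S) {a : Fin n → A} {c : ℝ} (hc : 0 ≤ c)
    (ha : ∀ i, ‖a i‖ ≤ c) : ‖∑ i, S i * a i * star (S i)‖ ≤ c := by
  let _ := CStarAlgebra.spectralOrder A
  have _ := CStarAlgebra.spectralOrderedRing A
  set x := ∑ i, S i * a i * star (S i) with hx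
  have hxx : star x * x = ∑ i, S i * (star (a i) * a i) * star (S i) := by
    refine hS.ext_corner fun k l => ?_
    have h1 : star x = ∑ i, S i * star (a i) * star (S i) := by
      simp [hx, mul_assoc]
    rw [hS.corner_mul, h1, hx]
    simp only [hS.corner_sum_conj]
    by_cases h : k = l <;> simp [h]
  have h2 (i : Fin n) : S i * (star (a i) * a i) * star (S i)
      ≤ (c ^ 2 : ℝ) • (S i * star (S i)) := by
    have h3 : star (a i) * a i ≤ algebraMap ℝ A (c ^ 2) := by
      refine CStarAlgebra.star_mul_le_algebraMap_norm_sq.trans ?_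
      rw [← sub_nonneg, ← map_sub]
      exact algebraMap_nonneg A (by nlinarith [ha i, norm_nonneg (a i)])
    have h4 := star_left_conjugate_le_conjugate h3 (star (S i))
    rwa [star_star, ← Algebra.commutes, mul_assoc, ← Algebra.smul_def, smul_mul_assoc,
      ← mul_assoc] at h4
  have h5 : ‖star x * x‖ ≤ c ^ 2 := by
    rw [CStarAlgebra.norm_le_iff_le_algebraMap _ (by positivity) (star_mul_self_nonneg x), hxx]
    refine (Finset.sum_le_sum fun i _ => h2 i).trans_eq ?_
    rw [← Finset.smul_sum, hS.sum_range, Algebra.algebraMap_eq_smul_one]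
  rw [CStarRing.norm_star_mul_self, ← sq] at h5
  exact (pow_le_pow_iff_left₀ (norm_nonneg x) hc two_ne_zero).1 h5

theorem range_projection_mem_diagonalAlgebra (hS : IsCuntzFamily S) (i : Fin n) :
    S i * star (S i) ∈ hS.diagonalAlgebra := by
  simpa using hS.conj_mem_diagonalAlgebra (one_mem _) i

theorem corner_eq_zero_of_commute (hS : IsCuntzFamily S) {x : A}
    (hx : ∀ d ∈ hS.diagonalAlgebra, d * x = x * d) {i j : Fin n} (hij : i ≠ j) :
    star (S i) * x * S j = 0 := by
  have h := hx _ (hS.range_projection_mem_diagonalAlgebra i)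
  calc star (S i) * x * S j = star (S i) * (S i * star (S i) * x) * S j := by
        simp only [mul_assoc, hS.star_mul_cancel]
    _ = star (S i) * x * S i * (star (S i) * S j) := by
        rw [h]
        simp only [mul_assoc]
    _ = 0 := by rw [hS.orthogonal i j hij, mul_zero]

theorem corner_commute (hS : IsCuntzFamily S) {x : A}
    (hx : ∀ d ∈ hS.diagonalAlgebra, d * x = x * d) (i : Fin n) :
    ∀ d ∈ hS.diagonalAlgebra, d * (star (S i) * x * S i) = star (S i) * x * S i * d := by
  intro d hd
  have h := congrArg (fun z => star (S i) * z * S i) (hx _ (hS.conj_mem_diagonalAlgebra hd i))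
  simpa only [mul_assoc, hS.star_mul_cancel, hS.isometry, mul_one] using h

theorem sum_corner_diagonal (hS : IsCuntzFamily S) {x : A}
    (hx : ∀ i j, i ≠ j → star (S i) * x * S j = 0) :
    ∑ i, S i * (star (S i) * x * S i) * star (S i) = x := by
  refine hS.ext_corner fun i j => ?_
  rw [hS.corner_sum_conj]
  split_ifs with h
  · rw [h]
  · rw [hx i j h]

/-- Since `x` is block diagonal, discarding the off-diagonal blocks of `y` does not worsen the
approximation. The blocks of `x` again commute with the diagonal, so this repeats down to level
zero, where the approximant is scalar. -/
theorem exists_diagonalLevel_near (hS : IsCuntzFamily S) {x y : A}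
    (hx : ∀ d ∈ hS.diagonalAlgebra, d * x = x * d) {k : ℕ} (hy : y ∈ cuntzCoreLevel S k) {ε : ℝ}
    (hε : 0 ≤ ε) (hxy : ‖x - y‖ ≤ ε) : ∃ d ∈ cuntzDiagonalLevel S k, ‖x - d‖ ≤ ε := by
  induction k generalizing x y with
  | zero => exact ⟨y, mem_diagonalLevel_zero.2 (mem_coreLevel_zero.1 hy), hxy⟩
  | succ k ih =>
    have hn (i : Fin n) : ‖S i‖ ≤ 1 := by
      have h := CStarRing.norm_star_mul_self (x := S i)
      rw [hS.isometry] at h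
      have h3 : ‖(1 : A)‖ ≤ 1 := by
        nontriviality A
        simp
      by_contra! h2
      nlinarith
    have hc (i : Fin n) : ‖star (S i) * x * S i - star (S i) * y * S i‖ ≤ ε := by
      rw [← sub_mul, ← mul_sub]
      calc ‖star (S i) * (x - y) * S i‖ ≤ ‖star (S i)‖ * ‖x - y‖ * ‖S i‖ :=
            (norm_mul_le _ _).trans (by gcongr; exact norm_mul_le _ _)
        _ ≤ 1 * ε * 1 := by
            rw [norm_star]
            gcongr
            exacts [hn i, hn i]
        _ = ε := by ring
    choose d hd hd' using fun i =>
      ih (hS.corner_commute hx i) (hS.mem_coreLevel_succ.1 hy i i) (hc i)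
    refine ⟨∑ i, S i * d i * star (S i),
      sum_mem fun i _ => conj_mem_diagonalLevel (hd i) i, ?_⟩
    rw [← hS.sum_corner_diagonal fun i j hij => hS.corner_eq_zero_of_commute hx hij,
      ← Finset.sum_sub_distrib]
    simp only [← sub_mul, ← mul_sub]
    refine hS.norm_sum_conj_le hε fun i => ?_
    have h3 : star (S i) * (∑ i, S i * (star (S i) * x * S i) * star (S i)) * S i
        = star (S i) * x * S i := by
      rw [hS.corner_sum_conj, if_pos rfl]
    simpa only [h3] using hd' i

theorem probe_mul_star_mem (hS : IsCuntzFamily S) (i j : Fin n) (a m : ℕ) :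
    hS.probe i j a m * star (hS.probe i j a m) ∈ hS.diagonalAlgebra := by
  rw [probe, ← map_star, ← map_mul]
  refine hS.shiftPow_mem_diagonalAlgebra a ?_
  induction m with
  | zero => simpa using hS.range_projection_mem_diagonalAlgebra j
  | succ m ih =>
    have := hS.conj_mem_diagonalAlgebra ih i
    simpa [pow_succ', mul_assoc] using this

/-- The difference `y = x - E(x)` commutes with the range projections of the probes, so compressing
is multiplicative on `y* y`. Hence `E(y* y) = E(y*) E(y) = 0`, and `y = 0` by faithfulness. -/
theorem mem_coreAlgebra_of_commute (hS : IsCuntzFamily S) (hn : 2 ≤ n) {x : A}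
    (hx : ∀ d ∈ hS.diagonalAlgebra, d * x = x * d) : x ∈ hS.coreAlgebra := by
  obtain ⟨i, j, hij⟩ : ∃ i j : Fin n, i ≠ j := ⟨⟨0, by lia⟩, ⟨1, by lia⟩, by simp⟩
  set y := x - hS.coreExpectation i j x with hy
  have hyd : ∀ d ∈ hS.diagonalAlgebra, d * y = y * d := by
    intro d hd
    have hd' := hS.diagonalAlgebra_le_coreAlgebra hd
    rw [hy, mul_sub, sub_mul, hx d hd, ← hS.coreExpectation_mul_left hij hd',
      ← hS.coreExpectation_mul_right hij hd', hx d hd]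
  have hy0 : hS.coreExpectation i j y = 0 := by
    rw [hy, hS.coreExpectation_sub hij,
      hS.coreExpectation_of_mem hij (hS.coreExpectation_mem hij x), sub_self]
  have hyy : hS.coreExpectation i j (star y * y) = 0 := by
    have h1 := (hS.tendsto_coreExpectation hij (star y)).mul (hS.tendsto_coreExpectation hij y)
    rw [hy0, mul_zero] at h1
    refine tendsto_nhds_unique (hS.tendsto_coreExpectation hij (star y * y)) (h1.congr fun k => ?_)
    have h2 := hyd _ (hS.probe_mul_star_mem i j k k)
    set W := hS.probe i j k k
    calc star W * star y * W * (star W * y * W)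
        = star W * star y * (W * star W * y) * W := by simp only [mul_assoc]
      _ = star W * (star y * y) * W * (star W * W) := by
          rw [h2]
          simp only [mul_assoc]
      _ = star W * (star y * y) * W := by rw [hS.star_probe_mul_self hij, mul_one]
  have hxe : x = hS.coreExpectation i j x :=
    sub_eq_zero.1 (hS.eq_zero_of_coreExpectation_eq_zero hij hyy)
  rw [hxe]
  exact hS.coreExpectation_mem hij x

/-- The diagonal is a maximal abelian subalgebra. -/
theorem mem_diagonalAlgebra_of_commute (hS : IsCuntzFamily S) (hn : 2 ≤ n) {x : A}
    (hx : ∀ d ∈ hS.diagonalAlgebra, d * x = x * d) : x ∈ hS.diagonalAlgebra := by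
  rw [mem_diagonalAlgebra, Metric.mem_closure_iff]
  intro ε hε
  obtain ⟨y, hy, hxy⟩ := Metric.mem_closure_iff.1
    (hS.mem_coreAlgebra.1 (hS.mem_coreAlgebra_of_commute hn hx)) (ε / 2) (half_pos hε)
  obtain ⟨k, hk⟩ := hS.mem_algebraicCore.1 hy
  rw [dist_eq_norm] at hxy
  obtain ⟨d, hd, hxd⟩ := hS.exists_diagonalLevel_near hx hk (half_pos hε).le hxy.le
  refine ⟨d, hS.mem_algebraicDiagonal.2 ⟨k, hd⟩, ?_⟩
  rw [dist_eq_norm]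
  linarith

end Masa

/-! ### The endomorphism and the three assertions. -/

section Endomorphism

variable {A : Type*} [CStarAlgebra A] {n : ℕ} {S : Fin n → A} {w : A} {lam : A →⋆ₐ[ℂ] A}

theorem exists_endomorphism [Nontrivial A] (hS : IsCuntzFamily S) (hn : 2 ≤ n)
    (hw : w ∈ unitary A) : ∃ lam : A →⋆ₐ[ℂ] A, ∀ i, lam (S i) = star w * S i := by
  have hw' (x : A) : w * (star w * x) = x := by
    rw [← mul_assoc, Unitary.mul_star_self_of_mem hw, one_mul]
  refine hS.exists_hom hn (fun i => ?_) (fun i j hij => ?_) ?_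
  · simp [mul_assoc, hw', hS.isometry]
  · simp [mul_assoc, hw', hS.orthogonal i j hij]
  · have h (i : Fin n) : star w * S i * star (star w * S i) = star w * (S i * star (S i)) * w := by
      simp [mul_assoc]
    simp only [h, ← Finset.sum_mul, ← Finset.mul_sum, hS.sum_range, mul_one]
    exact Unitary.star_mul_self_of_mem hw

theorem map_conj (hlam : ∀ i, lam (S i) = star w * S i) (x : A) (i j : Fin n) :
    lam (S i * x * star (S j)) = star w * (S i * lam x * star (S j)) * w := by
  simp [hlam, mul_assoc, map_star]

theorem map_mem_coreAlgebra (hS : IsCuntzFamily S) (hlam : ∀ i, lam (S i) = star w * S i)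
    (hwc : w ∈ hS.coreAlgebra) {x : A} (hx : x ∈ hS.coreAlgebra) : lam x ∈ hS.coreAlgebra := by
  have hl (k : ℕ) : ∀ x ∈ cuntzCoreLevel S k, lam x ∈ hS.coreAlgebra := by
    induction k with
    | zero =>
      intro x hx
      obtain ⟨c, rfl⟩ := mem_coreLevel_zero.1 hx
      rw [AlgHomClass.commutes]
      exact algebraMap_mem _ c
    | succ k ih =>
      intro x hx
      rw [← hS.sum_corner x]
      simp only [map_sum, map_conj hlam]
      exact sum_mem fun i _ => sum_mem fun j _ => mul_mem (mul_mem (star_mem hwc)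
        (hS.conj_mem_coreAlgebra (ih _ (hS.mem_coreLevel_succ.1 hx i j)) i j)) hwc
  refine closure_minimal (fun y hy => ?_)
    ((StarSubalgebra.isClosed_topologicalClosure _).preimage (continuous_starAlgHom lam)) hx
  obtain ⟨k, hk⟩ := hS.mem_algebraicCore.1 hy
  exact hl k y hk

/-- This says that the endomorphism preserves degree when `w` is in the core. -/
theorem exists_map_pow (hS : IsCuntzFamily S) (hlam : ∀ i, lam (S i) = star w * S i)
    (hwc : w ∈ hS.coreAlgebra) (i : Fin n) (d : ℕ) :
    ∃ u ∈ hS.coreAlgebra, lam (S i ^ d) = u * S i ^ d := by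
  induction d with
  | zero => exact ⟨1, one_mem _, by simp⟩
  | succ d ih =>
    obtain ⟨u, hu, h⟩ := ih
    refine ⟨star w * hS.shift u, mul_mem (star_mem hwc) ?_, ?_⟩
    · rw [shift_apply]
      exact sum_mem fun i _ => hS.conj_mem_coreAlgebra hu i i
    · rw [pow_succ', map_mul, h, hlam, mul_assoc, ← mul_assoc (S i), ← hS.shift_mul_generator]
      simp only [mul_assoc]

/-- Both sides are continuous and linear, so homogeneous elements suffice: in degree zero `E` acts
trivially, and in nonzero degree both sides vanish. -/
theorem map_coreExpectation (hS : IsCuntzFamily S) {i j : Fin n} (hij : i ≠ j)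
    (hlam : ∀ i, lam (S i) = star w * S i) (hwc : w ∈ hS.coreAlgebra) (x : A) :
    lam (hS.coreExpectation i j x) = hS.coreExpectation i j (lam x) := by
  have hc : Continuous lam := continuous_starAlgHom lam
  have hE := hS.continuous_coreExpectation hij
  have hcore {y : A} (hy : y ∈ hS.algebraicCore) (d : ℕ) :
      lam (hS.coreExpectation i j (y * S i ^ d)) = hS.coreExpectation i j (lam (y * S i ^ d)) := by
    have hy' : y ∈ hS.coreAlgebra := subset_closure hy
    have hly := hS.map_mem_coreAlgebra hlam hwc hy'
    rcases eq_or_ne d 0 with rfl | hd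
    · rw [pow_zero, mul_one, hS.coreExpectation_of_mem hij hy', hS.coreExpectation_of_mem hij hly]
    · obtain ⟨u, hu, h⟩ := hS.exists_map_pow hlam hwc i d
      rw [hS.coreExpectation_mul_left hij hy', hS.coreExpectation_pow hij hd, mul_zero, map_zero,
        map_mul, h, hS.coreExpectation_mul_left hij hly, hS.coreExpectation_mul_left hij hu,
        hS.coreExpectation_pow hij hd, mul_zero, mul_zero]
  refine closure_minimal (fun p hp => ?_) (isClosed_eq (hc.comp hE) (hE.comp hc))
    (hS.mem_closure_homogeneousSpan i x)
  change lam (hS.coreExpectation i j p) = hS.coreExpectation i j (lam p)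
  induction hp using Submodule.span_induction with
  | mem p h =>
    obtain ⟨d, y, hy, rfl⟩ | ⟨d, y, hy, rfl⟩ := h
    · exact hcore hy d
    · have := congrArg star (hcore (star_mem hy) d)
      simpa [← map_star, ← hS.coreExpectation_star hij] using this
  | zero =>
    have : hS.coreExpectation i j 0 = 0 := hS.coreExpectation_of_mem hij (zero_mem _)
    simp [this]
  | add x y _ _ hx hy => simp only [hS.coreExpectation_add hij, map_add, hx, hy]
  | smul c x _ hx => simp only [hS.coreExpectation_smul hij, map_smul, hx]

theorem bijective_iff_image_core [Nontrivial A] (hS : IsCuntzFamily S) (hn : 2 ≤ n)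
    (hw : w ∈ unitary A) (hlam : ∀ i, lam (S i) = star w * S i) (hwc : w ∈ cuntzCore S) :
    Function.Bijective lam ↔ lam '' cuntzCore S = cuntzCore S := by
  obtain ⟨i, j, hij⟩ : ∃ i j : Fin n, i ≠ j := ⟨⟨0, by lia⟩, ⟨1, by lia⟩, by simp⟩
  have hinj := hS.injective_of_nontrivial hn lam
  constructor
  · intro hbij
    refine Set.Subset.antisymm ?_ fun y hy => ?_
    · rintro _ ⟨x, hx, rfl⟩
      exact hS.map_mem_coreAlgebra hlam hwc hx
    · obtain ⟨x, rfl⟩ := hbij.2 y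
      refine ⟨x, ?_, rfl⟩
      have h : hS.coreExpectation i j x = x := by
        apply hinj
        rw [hS.map_coreExpectation hij hlam hwc, hS.coreExpectation_of_mem hij hy]
      rw [← h]
      exact hS.coreExpectation_mem hij x
  · intro himg
    refine ⟨hinj, hS.surjective_of_generators_mem hinj fun l => ?_⟩
    obtain ⟨v, -, hv⟩ : w ∈ lam '' cuntzCore S := by rwa [himg]
    refine ⟨v * S l, ?_⟩
    rw [map_mul, hv, hlam, ← mul_assoc, Unitary.mul_star_self_of_mem hw, one_mul]

theorem sum_corner_of_mem_diagonalAlgebra (hS : IsCuntzFamily S) {x : A}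
    (hx : x ∈ hS.diagonalAlgebra) :
    ∑ i, S i * (star (S i) * x * S i) * star (S i) = x :=
  hS.sum_corner_diagonal fun _ _ hij => hS.corner_eq_zero_of_commute
    (fun _ hd => hS.commute_of_mem_diagonalAlgebra hd hx) hij

theorem map_sum_conj (hlam : ∀ i, lam (S i) = star w * S i) (f : Fin n → A) :
    lam (∑ i, S i * f i * star (S i)) = star w * (∑ i, S i * lam (f i) * star (S i)) * w := by
  simp only [map_sum, map_conj hlam, ← Finset.sum_mul, ← Finset.mul_sum]

theorem map_mem_diagonalAlgebra (hS : IsCuntzFamily S) (hlam : ∀ i, lam (S i) = star w * S i)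
    (hwd : ∀ d ∈ hS.diagonalAlgebra, star w * d * w ∈ hS.diagonalAlgebra) {x : A}
    (hx : x ∈ hS.diagonalAlgebra) : lam x ∈ hS.diagonalAlgebra := by
  have hl (k : ℕ) : ∀ x ∈ cuntzDiagonalLevel S k, lam x ∈ hS.diagonalAlgebra := by
    induction k with
    | zero =>
      intro x hx
      obtain ⟨c, rfl⟩ := mem_diagonalLevel_zero.1 hx
      rw [AlgHomClass.commutes]
      exact algebraMap_mem _ c
    | succ k ih =>
      intro x hx
      have h := hS.mem_diagonalLevel_succ.1 hx
      rw [← hS.sum_corner_diagonal h.2, map_sum_conj hlam]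
      exact hwd _ (sum_mem fun i _ => hS.conj_mem_diagonalAlgebra (ih _ (h.1 i)) i)
  refine closure_minimal (fun y hy => ?_)
    ((StarSubalgebra.isClosed_topologicalClosure _).preimage (continuous_starAlgHom lam)) hx
  obtain ⟨k, hk⟩ := hS.mem_algebraicDiagonal.1 hy
  exact hl k y hk

theorem image_diagonal_iff_mem_unitaryNormalizer (hS : IsCuntzFamily S) (hn : 2 ≤ n)
    (hw : w ∈ unitary A) (hlam : ∀ i, lam (S i) = star w * S i)
    (hbij : Function.Bijective lam) :
    lam '' cuntzDiagonal S = cuntzDiagonal S ↔ w ∈ unitaryNormalizer (cuntzDiagonal S) := by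
  have hw1 (x : A) : star w * (w * x * star w) * w = x := by
    calc star w * (w * x * star w) * w = (star w * w) * x * (star w * w) := by
          simp only [mul_assoc]
      _ = x := by rw [Unitary.star_mul_self_of_mem hw, one_mul, mul_one]
  have hw2 (x : A) : w * (star w * x * w) * star w = x := by
    calc w * (star w * x * w) * star w = (w * star w) * x * (w * star w) := by
          simp only [mul_assoc]
      _ = x := by rw [Unitary.mul_star_self_of_mem hw, one_mul, mul_one]
  constructor
  · intro himg
    have hmap {x : A} (hx : x ∈ hS.diagonalAlgebra) : lam x ∈ hS.diagonalAlgebra := by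
      change lam x ∈ cuntzDiagonal S
      rw [← himg]
      exact ⟨x, hx, rfl⟩
    have hpre {y : A} (hy : y ∈ hS.diagonalAlgebra) : ∃ x ∈ hS.diagonalAlgebra, lam x = y := by
      have : y ∈ lam '' cuntzDiagonal S := himg.symm ▸ hy
      exact this
    refine ⟨hw, Set.Subset.antisymm ?_ fun y hy => ?_⟩
    · rintro _ ⟨y, hy, rfl⟩
      obtain ⟨x, hx, rfl⟩ := hpre hy
      change w * lam x * star w ∈ hS.diagonalAlgebra
      rw [← hS.sum_corner_of_mem_diagonalAlgebra hx, map_sum_conj hlam, hw2]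
      exact sum_mem fun i _ =>
        hS.conj_mem_diagonalAlgebra (hmap (hS.corner_mem_diagonalAlgebra hx i)) i
    -- Writing the corners of `y` as `λ(x_i)` with `x_i` in the diagonal gives `w* y w = λ(∑ S_i x_i
    -- S_i*)`.
    · refine ⟨star w * y * w, ?_, hw2 y⟩
      change star w * y * w ∈ hS.diagonalAlgebra
      choose x hx hxy using fun i => hpre (hS.corner_mem_diagonalAlgebra hy i)
      rw [← hS.sum_corner_of_mem_diagonalAlgebra hy]
      simp only [← hxy]
      rw [← map_sum_conj hlam]
      exact hmap (sum_mem fun i _ => hS.conj_mem_diagonalAlgebra (hx i) i)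
  · rintro ⟨-, hnorm⟩
    have hwd : ∀ d ∈ hS.diagonalAlgebra, star w * d * w ∈ hS.diagonalAlgebra := by
      intro d hd
      obtain ⟨e, he, rfl⟩ : d ∈ (fun d => w * d * star w) '' cuntzDiagonal S := hnorm.symm ▸ hd
      dsimp only
      rw [hw1]
      exact he
    refine Set.Subset.antisymm ?_ fun y hy => ?_
    · rintro _ ⟨x, hx, rfl⟩
      exact hS.map_mem_diagonalAlgebra hlam hwd hx
    · obtain ⟨x, rfl⟩ := hbij.2 y
      -- The images of `x` and `d` both lie in the commutative diagonal; injectivity makes `x`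
      -- commute with `d`, and the masa property applies.
      refine ⟨x, hS.mem_diagonalAlgebra_of_commute hn fun d hd => hbij.1 ?_, rfl⟩
      rw [map_mul, map_mul]
      exact hS.commute_of_mem_diagonalAlgebra (hS.map_mem_diagonalAlgebra hlam hwd hd) hy

/-- Compression by a generator fixes `y`, does not increase distances, and lowers the level of a
diagonal approximant by one. Repeating it turns the approximant into a scalar. -/
theorem exists_algebraMap_of_commute_generators [Nontrivial A] (hS : IsCuntzFamily S)
    (hn : 2 ≤ n) {y : A} (hy : y ∈ hS.diagonalAlgebra) (hc : ∀ i, y * S i = S i * y) :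
    y ∈ Set.range (algebraMap ℂ A) := by
  have hclosed : IsClosed (Set.range (algebraMap ℂ A)) :=
    (algebraMap_isometry ℂ A).isClosedEmbedding.isClosed_range
  have hnear (k : ℕ) : ∀ p ∈ cuntzDiagonalLevel S k, ∃ c : ℂ,
      ‖y - algebraMap ℂ A c‖ ≤ ‖y - p‖ := by
    let i : Fin n := ⟨0, by lia⟩
    have hi : ‖S i‖ * ‖S i‖ = 1 := by
      rw [← CStarRing.norm_star_mul_self, hS.isometry, norm_one]
    have hyi : star (S i) * y * S i = y := by
      rw [mul_assoc, hc, hS.star_mul_cancel]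
    induction k with
    | zero =>
      intro p hp
      obtain ⟨c, rfl⟩ := mem_diagonalLevel_zero.1 hp
      exact ⟨c, le_rfl⟩
    | succ k ih =>
      intro p hp
      obtain ⟨c, h⟩ := ih _ ((hS.mem_diagonalLevel_succ.1 hp).1 i)
      refine ⟨c, h.trans ?_⟩
      nth_rewrite 1 [← hyi]
      rw [← sub_mul, ← mul_sub]
      calc ‖star (S i) * (y - p) * S i‖ ≤ ‖star (S i)‖ * ‖y - p‖ * ‖S i‖ :=
            (norm_mul_le _ _).trans (by gcongr; exact norm_mul_le _ _)
        _ = (‖S i‖ * ‖S i‖) * ‖y - p‖ := by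
            rw [norm_star]
            ring
        _ = ‖y - p‖ := by rw [hi, one_mul]
  rw [← hclosed.closure_eq, Metric.mem_closure_iff]
  intro ε hε
  obtain ⟨p, hp, hyp⟩ := Metric.mem_closure_iff.1 (hS.mem_diagonalAlgebra.1 hy) ε hε
  obtain ⟨k, hk⟩ := hS.mem_algebraicDiagonal.1 hp
  obtain ⟨c, h⟩ := hnear k p hk
  rw [dist_eq_norm] at hyp
  exact ⟨_, ⟨c, rfl⟩, by rw [dist_eq_norm]; exact h.trans_lt hyp⟩

theorem centralizer_range_eq [Nontrivial A] (hS : IsCuntzFamily S) (hn : 2 ≤ n)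
    (himg : lam '' cuntzDiagonal S = cuntzDiagonal S) :
    Set.centralizer (Set.range lam) = Set.range (algebraMap ℂ A) := by
  refine Set.Subset.antisymm (fun x hx => ?_) ?_
  · rw [Set.mem_centralizer_iff] at hx
    have hxd : x ∈ hS.diagonalAlgebra := by
      refine hS.mem_diagonalAlgebra_of_commute hn fun d hd => ?_
      obtain ⟨e, -, rfl⟩ : d ∈ lam '' cuntzDiagonal S := himg.symm ▸ hd
      exact hx _ ⟨e, rfl⟩
    obtain ⟨y, hy, rfl⟩ : x ∈ lam '' cuntzDiagonal S := himg.symm ▸ hxd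
    obtain ⟨c, rfl⟩ := hS.exists_algebraMap_of_commute_generators hn hy fun i => by
      apply hS.injective_of_nontrivial hn lam
      rw [map_mul, map_mul]
      exact (hx _ ⟨S i, rfl⟩).symm
    exact ⟨c, (AlgHomClass.commutes lam c).symm⟩
  · rintro _ ⟨c, rfl⟩
    exact Set.mem_centralizer_iff.2 fun z _ => (Algebra.commutes c z).symm

end Endomorphism

end IsCuntzFamily

theorem proposition1p1 {n : ℕ} (hn : 2 ≤ n) {A : Type*} [CStarAlgebra A] [Nontrivial A]
    (S : Fin n → A) (hS : IsCuntzFamily S) (w : A) (hw : w ∈ unitary A) :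
    ∃ lam : A →⋆ₐ[ℂ] A,
      (∀ i, lam (S i) = star w * S i) ∧
      (∀ mu : A →⋆ₐ[ℂ] A, (∀ i, mu (S i) = star w * S i) → mu = lam) ∧
      (w ∈ cuntzCore S →
        (Function.Bijective lam ↔ lam '' cuntzCore S = cuntzCore S)) ∧
      (Function.Bijective lam →
        (lam '' cuntzDiagonal S = cuntzDiagonal S ↔
          w ∈ unitaryNormalizer (cuntzDiagonal S))) ∧
      (lam '' cuntzDiagonal S = cuntzDiagonal S →
        Set.centralizer (Set.range lam) = Set.range (algebraMap ℂ A)) := by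
  obtain ⟨lam, hlam⟩ := hS.exists_endomorphism hn hw
  exact ⟨lam, hlam, fun mu hmu => hS.hom_ext fun i => by rw [hmu, hlam],
    hS.bijective_iff_image_core hn hw hlam,
    hS.image_diagonal_iff_mem_unitaryNormalizer hn hw hlam,
    hS.centralizer_range_eq hn⟩
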